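/- Let $n\ge 2$ be an integer. A *signed permutation* of $\{1,\dots,n\}$ is a word $x=x_1x_2\cdots x_n$ with letters in $\{\pm1,\dots,\pm n\}$ such that $|x_1||x_2|\cdots|x_n|$ is a permutation of $\{1,\dots,n\}$. For $1\le i\le n$ its $i$-th *signed prefix reversal* is $x^i=(-x_i)(-x_{i-1})\cdots(-x_1)\,x_{i+1}\cdots x_n$. The *$n$-dimensional burnt pancake graph* $BP_n$ has the signed permutations of $\{1,\dots,n\}$ as its vertices, and $x$, $y$ are adjacent if and only if $y=x^i$ for some $1\le i\le n$. For a simple graph $G$ and $S\subseteq V(G)$, an *$S$-tree* is a subgraph $T$ of $G$ that is a tree with $S\subseteq V(T)$. The $S$-trees $T_1,\dots,T_r$ are *internally edge disjoint* if $V(T_i)\cap V(T_j)=S$ and $E(T_i)\cap E(T_j)=\emptyset$ for all $i\ne j$. Let $\kappa_G(S)$ be the maximum number of internally edge disjoint $S$-trees in $G$, and for $2\le k\le |V(G)|$ let $$\kappa_k(G)=\min\{\kappa_G(S) : S\subseteq V(G),\ |S|=k\}$$ be the *generalized $k$-connectivity* of $G$. **Theorem.** For every $n\ge 2$, $\kappa_3(BP_n)=n-1$.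 -/

import Mathlib

/-- Signed permutations `x₁ x₂ ⋯ xₙ` of `{1, …, n}`: words of length `n` in the nonzero integers
`±1, …, ±n` (a bar over a symbol is its negative) such that `|x₁| |x₂| ⋯ |xₙ|` is a permutation of
`{1, …, n}`. Positions are numbered from `0`. -/
@[ext]
structure SignedPerm (n : ℕ) where
  /-- the word `x₁ x₂ ⋯ xₙ` -/
  word : Fin n → ℤ
  bijOn_abs : Set.BijOn (fun j => |word j|) Set.univ (Set.Icc 1 (n : ℤ))

namespace SignedPerm

variable {n : ℕ}

/-- The involution of the positions that reverses the positions `0, …, i` and fixes the others. -/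
def revPos (i j : Fin n) : Fin n :=
  if j ≤ i then ⟨i.val - j.val, by omega⟩ else j

theorem revPos_revPos (i j : Fin n) : revPos i (revPos i j) = j := by
  unfold revPos
  ext
  simp only [Fin.le_def]
  split_ifs <;> simp only at * <;> omega

theorem revPos_le_iff (i j : Fin n) : revPos i j ≤ i ↔ j ≤ i := by
  unfold revPos
  simp only [Fin.le_def]
  split_ifs <;> grind

/-- The signed prefix reversal of the prefix in the positions `0, …, i`:
the word `x₁ ⋯ xₙ` is sent to `(-x_{i+1}) (-x_i) ⋯ (-x₁) x_{i+2} ⋯ xₙ`. -/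
def prefixReversal (i : Fin n) (x : SignedPerm n) : SignedPerm n where
  word j := if j ≤ i then -x.word (revPos i j) else x.word (revPos i j)
  bijOn_abs := by
    have h : (fun j => |if j ≤ i then -x.word (revPos i j) else x.word (revPos i j)|)
        = (fun j => |x.word j|) ∘ revPos i := by
      funext j
      by_cases hj : j ≤ i <;> simp [hj]
    rw [h]
    refine x.bijOn_abs.comp ?_
    exact Set.bijOn_univ.2 (Function.Involutive.bijective (revPos_revPos i))

theorem prefixReversal_prefixReversal (i : Fin n) (x : SignedPerm n) :
    prefixReversal i (prefixReversal i x) = x := by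
  ext j
  by_cases hj : j ≤ i <;> simp [prefixReversal, revPos_le_iff, revPos_revPos, hj]

theorem prefixReversal_ne (i : Fin n) (x : SignedPerm n) : prefixReversal i x ≠ x := by
  intro h
  have hw : -x.word (revPos i i) = x.word i := by
    simpa [prefixReversal] using congrFun (congrArg word h) i
  have hinj : revPos i i = i := by
    apply x.bijOn_abs.injOn (Set.mem_univ _) (Set.mem_univ _)
    simp only [← hw, abs_neg]
  have hpos := (x.bijOn_abs.mapsTo (Set.mem_univ i)).1
  rw [hinj] at hw
  have h0 : x.word i = 0 := by omega
  simp [h0] at hpos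

end SignedPerm

/-- The `n`-dimensional burnt pancake graph: two signed permutations are adjacent iff one is
obtained from the other by a signed prefix reversal of some length between `1` and `n`. -/
def burntPancakeGraph (n : ℕ) : SimpleGraph (SignedPerm n) where
  Adj x y := ∃ i : Fin n, x.prefixReversal i = y
  symm := ⟨by
    rintro x y ⟨i, rfl⟩
    exact ⟨i, SignedPerm.prefixReversal_prefixReversal i x⟩⟩
  loopless := ⟨by
    rintro x ⟨i, h⟩
    exact SignedPerm.prefixReversal_ne i x h⟩

namespace SimpleGraph

/-- `T` is a tree in `G` that contains all the vertices of `S`. -/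
def IsSteinerTree {V : Type*} (G : SimpleGraph V) (S : Set V) (T : G.Subgraph) : Prop :=
  T.coe.IsTree ∧ S ⊆ T.verts

/-- `T₁, …, T_r` are internally edge disjoint `S`-trees: any two of them have exactly the
vertices of `S` in common, and no edge. -/
def InternallyDisjointTrees {V : Type*} (G : SimpleGraph V) (S : Set V) {r : ℕ}
    (T : Fin r → G.Subgraph) : Prop :=
  (∀ i, G.IsSteinerTree S (T i)) ∧
    ∀ i j, i ≠ j → (T i).verts ∩ (T j).verts = S ∧ (T i).edgeSet ∩ (T j).edgeSet = ∅

/-- `κ_G(S)`: the maximum number of internally edge disjoint `S`-trees in `G`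
(`⊤` if there are such families of every size). -/
noncomputable def treeConnectivity {V : Type*} (G : SimpleGraph V) (S : Set V) : ℕ∞ :=
  ⨆ (r : ℕ) (_ : ∃ T : Fin r → G.Subgraph, G.InternallyDisjointTrees S T), (r : ℕ∞)

/-- The generalized `k`-connectivity `κ_k(G)`: the minimum of `κ_G(S)` over all sets `S` of
exactly `k` vertices (`⊤` if there is no such set). -/
noncomputable def generalizedConnectivity {V : Type*} (G : SimpleGraph V) (k : ℕ) : ℕ∞ :=
  ⨅ (S : Finset V) (_ : S.card = k), G.treeConnectivity (S : Set V)

end SimpleGraph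

/-! ### Closed sets of vertices and Menger's theorem -/

namespace SimpleGraph

variable {V : Type*}

/-! Upper bound: let `x`, `y` be adjacent and `z` a third vertex. All degrees are at most `n`, so
`n` edge disjoint trees through `x`, `y`, `z` would use each edge at `x` and at `y`, and every tree
would have just one edge at each of them. The tree that contains the edge `xy` could then never
leave `{x, y}`, so it would miss `z` (`InternallyDisjointTrees.lt_of_adj`).

Lower bound: fixing all letters from position `m` on gives a cell, a copy of `BP_m`. A cell of size
`p + 1` splits into slices, which are cells of size `p`, according to the letter in position `p`.
Each vertex has exactly one edge that leaves its slice inside the larger cell, the reversal of the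
first `p + 1` letters. Slices with labels `a ≠ ±b` are joined by at least `p` such edges.
`IsLayered` records what is needed of this structure, and two inductions run on it.

The first (`IsLayered.connectedOn_succ`) shows that the cell of size `m` stays connected when fewer
than `m` vertices are removed. The second (`IsLayered.triplePacked_succ`) builds `k` suitable
subgraphs around three vertices. If all three lie in one slice, induction gives `k - 1` of them and
one more runs through the other slices. Otherwise two of them, in one slice or in two slices with
non-opposite labels, are joined by `k` internally disjoint connected subgraphs, each with its own
exit to the remaining slices. The union of those slices is highly connected, because it contains the
slice opposite to a missing one, so a fan from the third vertex picks up all exits.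

Menger's theorem supplies the connections and the fans. Connected sets replace paths throughout;
spanning trees are chosen only at the end. -/

theorem Preconnected.mem_of_closed {G : SimpleGraph V} (h : G.Preconnected) {T : Set V}
    (hT : ∀ u ∈ T, ∀ v, G.Adj u v → v ∈ T) {a : V} (ha : a ∈ T) (b : V) : b ∈ T := by
  obtain ⟨p⟩ := h a b
  induction p with
  | nil => exact ha
  | cons hadj _ ih => exact ih (hT _ ha _ hadj)

theorem subset_of_induce_preconnected {G : SimpleGraph V} {F T : Set V}
    (h : (G.induce F).Preconnected) {a : V} (haF : a ∈ F) (haT : a ∈ T)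
    (hT : ∀ u ∈ F, u ∈ T → ∀ v ∈ F, G.Adj u v → v ∈ T) : F ⊆ T := fun b hb =>
  h.mem_of_closed (T := {v : F | (v : V) ∈ T})
    (fun u hu v huv => hT u u.2 hu v v.2 huv) (a := ⟨a, haF⟩) haT ⟨b, hb⟩

theorem induce_connected_of_forall_subset {G : SimpleGraph V} {F : Set V} {a : V} (haF : a ∈ F)
    (h : ∀ T : Set V, a ∈ T → (∀ u ∈ F, u ∈ T → ∀ v ∈ F, G.Adj u v → v ∈ T) → F ⊆ T) :
    (G.induce F).Connected := by
  rw [connected_iff_exists_forall_reachable]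
  refine ⟨⟨a, haF⟩, ?_⟩
  have := h {v | ∀ hv : v ∈ F, (G.induce F).Reachable ⟨a, haF⟩ ⟨v, hv⟩} (fun _ => Reachable.rfl) ?_
  · rintro ⟨v, hv⟩
    exact this hv hv
  · intro u hu huT v hv hadj _
    exact (huT hu).trans (Adj.reachable (by simpa using hadj))

theorem induce_singleton_connected (G : SimpleGraph V) (a : V) : (G.induce {a}).Connected :=
  induce_connected_of_forall_subset (Set.mem_singleton a) fun T ha _ => by simpa using ha

/-- `Z` separates `A` from `B`, witnessed by a set `T` that contains the rest of `A`, avoids `B`,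
and can only be left through `Z`. -/
structure IsSeparation (G : SimpleGraph V) (A B T Z : Set V) : Prop where
  subset : A ⊆ T ∪ Z
  closed : ∀ u ∈ T, ∀ v, G.Adj u v → v ∈ T ∪ Z
  disjoint : Disjoint T B

/-- There are `k` pairwise disjoint connected sets of vertices that meet both `A` and `B`. -/
def Linked (G : SimpleGraph V) (A B : Set V) (k : ℕ) : Prop :=
  ∃ F : Fin k → Set V,
    (∀ i, (G.induce (F i)).Connected ∧ (F i ∩ A).Nonempty ∧ (F i ∩ B).Nonempty) ∧
    Pairwise fun i j => Disjoint (F i) (F j)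

theorem Linked.mono {G H : SimpleGraph V} (hGH : G ≤ H) {A B : Set V} {k : ℕ}
    (h : G.Linked A B k) : H.Linked A B k := by
  obtain ⟨F, hF, hd⟩ := h
  exact ⟨F, fun i => ⟨(hF i).1.mono (fun _ _ h => hGH h), (hF i).2⟩, hd⟩

theorem Linked.symm {G : SimpleGraph V} {A B : Set V} {k : ℕ}
    (h : G.Linked A B k) : G.Linked B A k := by
  obtain ⟨F, hF, hd⟩ := h
  exact ⟨F, fun i => ⟨(hF i).1, (hF i).2.2, (hF i).2.1⟩, hd⟩

theorem Linked.of_family [Finite V] {G : SimpleGraph V} {A B P : Set V} (F : V → Set V)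
    (hF : ∀ p ∈ P, (G.induce (F p)).Connected ∧ (F p ∩ A).Nonempty ∧ (F p ∩ B).Nonempty)
    (hd : ∀ p ∈ P, ∀ q ∈ P, p ≠ q → Disjoint (F p) (F q)) {k : ℕ} (hk : k ≤ P.ncard) :
    G.Linked A B k := by
  let e : Fin P.ncard ≃ P := (Finite.equivFin P).symm
  let f : Fin k → P := fun i => e (Fin.castLE hk i)
  have hf : Function.Injective f := e.injective.comp (Fin.castLE_injective hk)
  exact ⟨fun i => F (f i), fun i => hF _ (f i).2,
    fun i j hij => hd _ (f i).2 _ (f j).2 fun h => hij (hf (Subtype.ext h))⟩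

/-- The `k` disjoint sets contain distinct points of `P`, and these exhaust `P` because `|P| = k`.
Indexing by `P` allows two linkages that end at a common separator to be glued point by point. -/
theorem Linked.exists_family [Finite V] {G : SimpleGraph V} {A P : Set V} {k : ℕ}
    (h : G.Linked A P k) (hk : P.ncard = k) :
    ∃ F : V → Set V, (∀ p ∈ P, p ∈ F p ∧ (G.induce (F p)).Connected ∧ (F p ∩ A).Nonempty) ∧
      ∀ p ∈ P, ∀ q ∈ P, p ≠ q → Disjoint (F p) (F q) := by
  classical
  obtain ⟨F, hF, hd⟩ := h
  choose f hf using fun i => (hF i).2.2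
  have hinj : Function.Injective f := by
    intro i j hij
    by_contra hne
    exact Set.disjoint_left.1 (hd hne) (hf i).1 (hij ▸ (hf j).1)
  have himg : Set.range f = P := by
    refine Set.eq_of_subset_of_ncard_le ?_ ?_
    · rintro _ ⟨i, rfl⟩
      exact (hf i).2
    · rw [← Set.image_univ, Set.ncard_image_of_injective _ hinj, Set.ncard_univ]
      simp [hk]
  have hex : ∀ p : V, ∃ S : Set V, p ∈ P → ∃ i, f i = p ∧ S = F i := by
    intro p
    by_cases hp : p ∈ P
    · rw [← himg] at hp
      obtain ⟨i, hi⟩ := hp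
      exact ⟨F i, fun _ => ⟨i, hi, rfl⟩⟩
    · exact ⟨∅, fun h => absurd h hp⟩
  choose F' hF' using hex
  refine ⟨F', fun p hp => ?_, fun p hp q hq hpq => ?_⟩
  · obtain ⟨i, hi, hi'⟩ := hF' p hp
    rw [hi']
    exact ⟨hi ▸ (hf i).1, (hF i).1, (hF i).2.1⟩
  · obtain ⟨i, hi, hi'⟩ := hF' p hp
    obtain ⟨j, hj, hj'⟩ := hF' q hq
    rw [hi', hj']
    exact hd fun hij => hpq (by rw [← hi, ← hj, hij])

/-- **Menger's theorem**, for sets of vertices of a finite graph. -/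
theorem linked_of_forall_isSeparation [Finite V] (G : SimpleGraph V) (A B : Set V) (k : ℕ)
    (h : ∀ T Z, G.IsSeparation A B T Z → k ≤ Z.ncard) : G.Linked A B k := by
  classical
  induction G using WellFoundedLT.induction generalizing A B with
  | ind G ih =>
  by_cases hG : ∃ x y, G.Adj x y
  swap
  · push Not at hG
    refine Linked.of_family (P := A ∩ B) (fun v => {v}) ?_ ?_
      (h (A \ B) (A ∩ B) ⟨by simp, fun u _ v huv => absurd huv (hG u v), Set.disjoint_sdiff_left⟩)
    · rintro p ⟨hpA, hpB⟩
      exact ⟨induce_singleton_connected G p, ⟨p, rfl, hpA⟩, ⟨p, rfl, hpB⟩⟩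
    · intro p _ q _ hpq
      simpa using hpq
  obtain ⟨x₀, y₀, hxy₀⟩ := hG
  have hlt : G.deleteEdges {s(x₀, y₀)} < G := by
    refine lt_of_le_of_ne (deleteEdges_le _) fun heq => ?_
    rw [← heq] at hxy₀
    simp [deleteEdges_adj] at hxy₀
  by_cases hH : ∀ T Z, (G.deleteEdges {s(x₀, y₀)}).IsSeparation A B T Z → k ≤ Z.ncard
  · exact (ih _ hlt A B hH).mono hlt.le
  push Not at hH
  obtain ⟨T₀, S, hsep₀, hSk⟩ := hH
  obtain ⟨T, hsep, hTS⟩ : ∃ T, (G.deleteEdges {s(x₀, y₀)}).IsSeparation A B T S ∧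
      ∀ v ∈ T, v ∉ S := by
    refine ⟨T₀ \ S, ⟨?_, ?_, hsep₀.disjoint.mono_left Set.sdiff_subset⟩, fun v hv => hv.2⟩
    · simpa using hsep₀.subset
    · intro u hu v huv
      simpa using hsep₀.closed u hu.1 v huv
  -- The deleted edge must run from `T` to a vertex outside `T ∪ S`; otherwise the small set `S`
  -- would already separate `A` from `B` in `G`.
  obtain ⟨x, y, hxy, hx, hy, hyS⟩ :
      ∃ x y, s(x₀, y₀) = s(x, y) ∧ x ∈ T ∧ y ∉ T ∧ y ∉ S := by
    by_contra hcon
    push Not at hcon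
    refine absurd (h T S ⟨hsep.subset, fun u hu v huv => ?_, hsep.disjoint⟩) (by omega)
    by_cases he : s(u, v) = s(x₀, y₀)
    · by_cases hvT : v ∈ T
      · exact Or.inl hvT
      · exact Or.inr (hcon u v he.symm hu hvT)
    · exact hsep.closed u hu v (by simp [deleteEdges_adj, huv, he])
  have hHadj : ∀ u v, (G.deleteEdges {s(x₀, y₀)}).Adj u v ↔ G.Adj u v ∧ s(u, v) ≠ s(x, y) := by
    intro u v
    rw [deleteEdges_adj, hxy, Set.mem_singleton_iff]
  set H := G.deleteEdges {s(x₀, y₀)} with hHdef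
  have hxyG : G.Adj x y := by
    rw [← mem_edgeSet, ← hxy, mem_edgeSet]
    exact hxy₀
  have hxS : x ∉ S := hTS x hx
  have hcl : ∀ u ∈ T, ∀ v, G.Adj u v → v ∈ T ∪ S ∨ (u = x ∧ v = y) := by
    intro u hu v huv
    by_cases he : s(u, v) = s(x, y)
    · rw [Sym2.eq_iff] at he
      rcases he with he | he
      · exact Or.inr he
      · exact absurd (he.1 ▸ hu) hy
    · exact Or.inl (hsep.closed u hu v ((hHadj u v).2 ⟨huv, he⟩))
  have hQ : k ≤ (insert y S).ncard := by
    refine h T (insert y S) ⟨?_, fun u hu v huv => ?_, hsep.disjoint⟩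
    · exact hsep.subset.trans (Set.union_subset_union_right _ (Set.subset_insert _ _))
    · rcases hcl u hu v huv with (hv | hv) | hv
      · exact Or.inl hv
      · exact Or.inr (Or.inr hv)
      · exact Or.inr (Or.inl hv.2)
  have hQk : (insert y S).ncard = k := by
    rw [Set.ncard_insert_of_notMem hyS] at hQ ⊢
    omega
  have hPk : (insert x S).ncard = k := by
    rw [Set.ncard_insert_of_notMem hyS] at hQk
    rwa [Set.ncard_insert_of_notMem hxS]
  -- `G₁` is the side of `A` and `G₂` the side of `B`. A separation of `A` from `S ∪ {x}` in `G₁`,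
  -- or of `S ∪ {y}` from `B` in `G₂`, extends to one of `A` from `B` in `G`, so the induction
  -- hypothesis applies to both.
  let G₁ : SimpleGraph V :=
    { Adj := fun u v => H.Adj u v ∧ (u ∈ T ∨ v ∈ T)
      symm := ⟨fun u v h => ⟨h.1.symm, h.2.symm⟩⟩
      loopless := ⟨fun u h => H.loopless.irrefl u h.1⟩ }
  let G₂ : SimpleGraph V :=
    { Adj := fun u v => H.Adj u v ∧ (u ∉ T ∪ S ∨ v ∉ T ∪ S)
      symm := ⟨fun u v h => ⟨h.1.symm, h.2.symm⟩⟩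
      loopless := ⟨fun u h => H.loopless.irrefl u h.1⟩ }
  have hG₁ : G₁ ≤ H := fun u v h => h.1
  have hG₂ : G₂ ≤ H := fun u v h => h.1
  have hL₁ : G₁.Linked A (insert x S) k := by
    refine ih G₁ (lt_of_le_of_lt hG₁ hlt) _ _ fun T₁ Z₁ hs => ?_
    refine h (T₁ ∩ T) Z₁ ⟨fun a ha => ?_, ?_, hsep.disjoint.mono_left Set.inter_subset_right⟩
    · rcases hs.subset ha with ha₁ | ha₁
      · refine Or.inl ⟨ha₁, (hsep.subset ha).resolve_right fun haS => ?_⟩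
        exact Set.disjoint_left.1 hs.disjoint ha₁ (Or.inr haS)
      · exact Or.inr ha₁
    · rintro u ⟨hu₁, hu⟩ v huv
      have hux : u ≠ x := fun hux => Set.disjoint_left.1 hs.disjoint hu₁ (Or.inl hux)
      have hv := (hcl u hu v huv).resolve_right fun h => hux h.1
      have huvH : H.Adj u v := (hHadj u v).2 ⟨huv, fun he => by
        rw [Sym2.eq_iff] at he
        rcases he with he | he
        · exact hux he.1
        · exact hy (he.1 ▸ hu)⟩
      rcases hs.closed u hu₁ v ⟨huvH, Or.inl hu⟩ with hv₁ | hv₁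
      · refine Or.inl ⟨hv₁, hv.resolve_right fun hvS => ?_⟩
        exact Set.disjoint_left.1 hs.disjoint hv₁ (Or.inr hvS)
      · exact Or.inr hv₁
  have hL₂ : G₂.Linked (insert y S) B k := by
    refine ih G₂ (lt_of_le_of_lt hG₂ hlt) _ _ fun T₂ Z₂ hs => ?_
    have hS₂ : S ⊆ T₂ ∪ Z₂ := fun v hv => hs.subset (Or.inr hv)
    refine h (T ∪ T₂) Z₂ ⟨fun a ha => ?_, ?_,
      Set.disjoint_union_left.2 ⟨hsep.disjoint, hs.disjoint⟩⟩
    · rw [Set.union_assoc]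
      rcases hsep.subset ha with ha | ha
      · exact Or.inl ha
      · exact Or.inr (hS₂ ha)
    · intro u hu v huv
      rw [Set.union_assoc]
      by_cases huT : u ∈ T
      · rcases hcl u huT v huv with (hv | hv) | hv
        · exact Or.inl hv
        · exact Or.inr (hS₂ hv)
        · exact Or.inr (hv.2 ▸ hs.subset (Or.inl rfl))
      by_cases hv : v ∈ T ∪ S
      · rcases hv with hv | hv
        · exact Or.inl hv
        · exact Or.inr (hS₂ hv)
      have huvH : H.Adj u v := (hHadj u v).2 ⟨huv, fun he => by
        rw [Sym2.eq_iff] at he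
        rcases he with he | he
        · exact huT (he.1 ▸ hx)
        · exact hv (Or.inl (he.2 ▸ hx))⟩
      exact Or.inr (hs.closed u (hu.resolve_left huT) v ⟨huvH, Or.inr hv⟩)
  obtain ⟨F, hF, hFd⟩ := hL₁.exists_family hPk
  obtain ⟨F', hF', hFd'⟩ := hL₂.symm.exists_family hQk
  have hFT : ∀ p ∈ insert x S, F p ⊆ T ∪ S := by
    intro p hp
    obtain ⟨_, hc, a, haF, haA⟩ := hF p hp
    refine subset_of_induce_preconnected hc.preconnected haF (hsep.subset haA) ?_
    rintro u _ hu v _ ⟨huv, huT | hvT⟩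
    · exact hsep.closed u huT v huv
    · exact Or.inl hvT
  have hFT' : ∀ q ∈ insert y S, F' q ⊆ Tᶜ := by
    intro q hq
    obtain ⟨_, hc, b, hbF, hbB⟩ := hF' q hq
    refine subset_of_induce_preconnected hc.preconnected hbF
      (fun hb => Set.disjoint_left.1 hsep.disjoint hb hbB) ?_
    rintro u _ hu v _ ⟨huv, hu' | hv'⟩
    · exact fun hv => hu' (hsep.closed v hv u huv.symm)
    · exact fun hv => hv' (Or.inl hv)
  have hmeet : ∀ p ∈ insert x S, ∀ q ∈ insert y S, ∀ v, v ∈ F p → v ∈ F' q →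
      v ∈ S ∧ v = p ∧ v = q := by
    intro p hp q hq v hv hv'
    have hvS : v ∈ S := (hFT p hp hv).resolve_left (hFT' q hq hv')
    refine ⟨hvS, ?_, ?_⟩
    · by_contra hne
      exact Set.disjoint_left.1 (hFd v (Or.inr hvS) p hp hne) (hF v (Or.inr hvS)).1 hv
    · by_contra hne
      exact Set.disjoint_left.1 (hFd' v (Or.inr hvS) q hq hne) (hF' v (Or.inr hvS)).1 hv'
  have hle₁ : G₁ ≤ G := hG₁.trans hlt.le
  have hle₂ : G₂ ≤ G := hG₂.trans hlt.le
  -- The two linkages are glued at each vertex of `S`, and along the deleted edge `xy` for the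
  -- remaining pair.
  let σ : V → V := fun p => if p = x then y else p
  have hσ : ∀ p ∈ insert x S, σ p ∈ insert y S := by
    intro p hp
    by_cases hpx : p = x
    · simp [σ, hpx]
    · have : σ p = p := by simp [σ, hpx]
      rw [this]
      exact Or.inr (hp.resolve_left hpx)
  have hσinj : ∀ p ∈ insert x S, ∀ q ∈ insert x S, σ p = σ q → p = q := by
    intro p hp q hq hpq
    by_cases hpx : p = x <;> by_cases hqx : q = x
    · rw [hpx, hqx]
    · simp only [σ, hpx, hqx, if_true, if_false] at hpq
      exact absurd (hq.resolve_left hqx) (hpq ▸ hyS)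
    · simp only [σ, hpx, hqx, if_true, if_false] at hpq
      exact absurd (hp.resolve_left hpx) (hpq ▸ hyS)
    · simpa [σ, hpx, hqx] using hpq
  have hcross : ∀ p ∈ insert x S, ∀ q ∈ insert x S, p ≠ q → Disjoint (F p) (F' (σ q)) := by
    intro p hp q hq hpq
    refine Set.disjoint_left.2 fun v hv hv' => ?_
    obtain ⟨hvS, hvp, hvq⟩ := hmeet p hp _ (hσ q hq) v hv hv'
    by_cases hqx : q = x
    · simp only [σ, hqx, if_true] at hvq
      exact hyS (hvq ▸ hvS)
    · simp only [σ, hqx, if_false] at hvq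
      exact hpq (hvp ▸ hvq)
  refine Linked.of_family (P := insert x S) (fun p => F p ∪ F' (σ p)) (fun p hp => ?_) ?_ hPk.ge
  · obtain ⟨hpF, hc, a, haF, haA⟩ := hF p hp
    obtain ⟨hpF', hc', b, hbF, hbB⟩ := hF' (σ p) (hσ p hp)
    have hc₁ : (G.induce (F p)).Connected := hc.mono fun _ _ h => hle₁ h
    have hc₂ : (G.induce (F' (σ p))).Connected := hc'.mono fun _ _ h => hle₂ h
    refine ⟨?_, ⟨a, Or.inl haF, haA⟩, ⟨b, Or.inr hbF, hbB⟩⟩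
    by_cases hpx : p = x
    · refine connected_induce_union hc₁.preconnected hc₂.preconnected hpF hpF' ?_
      simpa [σ, hpx] using hxyG
    · refine induce_union_connected hc₁.preconnected hc₂.preconnected ⟨p, hpF, ?_⟩
      simpa [σ, hpx] using hpF'
  · intro p hp q hq hpq
    rw [Set.disjoint_union_left, Set.disjoint_union_right, Set.disjoint_union_right]
    exact ⟨⟨hFd p hp q hq hpq, hcross p hp q hq hpq⟩, (hcross q hq p hp hpq.symm).symm,
      hFd' _ (hσ p hp) _ (hσ q hq) fun h => hpq (hσinj p hp q hq h)⟩

end SimpleGraph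

/-! ### Fans and packings of connected subgraphs -/

namespace SimpleGraph

variable {V : Type*}

/-- Removing fewer than `k` vertices does not disconnect the part of `G` on the set `s`. -/
def ConnectedOn (G : SimpleGraph V) (k : ℕ) (s : Set V) : Prop :=
  ∀ D : Set V, D.ncard < k → (G.induce (s \ D)).Connected

/-- The graph with the edges of `G` that have both ends in `s`. -/
def within (G : SimpleGraph V) (s : Set V) : SimpleGraph V where
  Adj u v := G.Adj u v ∧ u ∈ s ∧ v ∈ s
  symm := ⟨fun _ _ h => ⟨h.1.symm, h.2.2, h.2.1⟩⟩
  loopless := ⟨fun u h => G.loopless.irrefl u h.1⟩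

theorem within_le (G : SimpleGraph V) (s : Set V) : G.within s ≤ G := fun _ _ h => h.1

theorem subset_of_within_connected {G : SimpleGraph V} {s F : Set V}
    (h : ((G.within s).induce F).Connected) {a : V} (haF : a ∈ F) (has : a ∈ s) : F ⊆ s :=
  subset_of_induce_preconnected h.preconnected haF has fun _ _ _ _ _ huv => huv.2.2

/-- The **fan lemma**. -/
theorem ConnectedOn.exists_fan [Finite V] {G : SimpleGraph V} {s : Set V} {k : ℕ}
    (hs : G.ConnectedOn k s) {x : V} (hx : x ∈ s) (hdeg : k ≤ {v ∈ s | G.Adj x v}.ncard + 1)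
    {u : Fin k → V} (hu : Function.Injective u) (hus : ∀ i, u i ∈ s) :
    ∃ F : Fin k → Set V,
      (∀ i, x ∈ F i ∧ u i ∈ F i ∧ F i ⊆ s ∧ (G.induce (F i)).Connected) ∧
      ∀ i j, i ≠ j → F i ∩ F j ⊆ {x} := by
  have hW : (Set.range u).ncard = k := by
    rw [← Set.image_univ, Set.ncard_image_of_injective _ hu, Set.ncard_univ]
    simp
  have hA : k ≤ (insert x {v ∈ s | G.Adj x v}).ncard := by
    rwa [Set.ncard_insert_of_notMem fun h => G.loopless.irrefl x h.2]
  -- The source includes `x` itself, since `x` may be one of the targets; this also accounts for the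
  -- `+ 1` in the degree bound.
  have hlink : (G.within s).Linked (insert x {v ∈ s | G.Adj x v}) (Set.range u) k := by
    refine linked_of_forall_isSeparation _ _ _ _ fun T Z hTZ => ?_
    by_contra! hZ
    obtain ⟨_, ⟨i, rfl⟩, hiZ⟩ := Set.exists_mem_notMem_of_ncard_lt_ncard (hZ.trans_eq hW.symm)
    obtain ⟨a, ha, haZ⟩ := Set.exists_mem_notMem_of_ncard_lt_ncard (hZ.trans_le hA)
    have has : a ∈ s := by
      rcases ha with rfl | ha
      exacts [hx, ha.1]
    have hsub : s \ Z ⊆ T := by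
      refine subset_of_induce_preconnected (hs Z hZ).preconnected ⟨has, haZ⟩
        ((hTZ.subset ha).resolve_right haZ) fun p hp hpT q hq hpq => ?_
      exact (hTZ.closed p hpT q ⟨hpq, hp.1, hq.1⟩).resolve_right hq.2
    exact Set.disjoint_left.1 hTZ.disjoint (hsub ⟨hus i, hiZ⟩) ⟨i, rfl⟩
  obtain ⟨F, hF, hd⟩ := hlink.exists_family hW
  refine ⟨fun i => insert x (F (u i)), fun i => ?_, fun i j hij => ?_⟩
  · obtain ⟨hi, hc, a, haF, haA⟩ := hF (u i) ⟨i, rfl⟩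
    have hsub : F (u i) ⊆ s := subset_of_within_connected hc hi (hus i)
    have hc' : (G.induce (F (u i))).Connected := hc.mono fun _ _ h => G.within_le s h
    refine ⟨Or.inl rfl, Or.inr hi, Set.insert_subset hx hsub, ?_⟩
    rcases haA with rfl | ha
    · change (G.induce (insert a (F (u i)))).Connected
      rwa [Set.insert_eq_of_mem haF]
    · exact connected_induce_union (induce_singleton_connected G x).preconnected hc'.preconnected
        (Set.mem_singleton x) haF ha.2
  · rintro v ⟨hv | hv, hv' | hv'⟩
    · exact hv
    · exact hv
    · exact hv'
    · exact absurd hv' (Set.disjoint_left.1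
        (hd (u i) ⟨i, rfl⟩ (u j) ⟨j, rfl⟩ fun h => hij (hu h)) hv)

/-- Connected subgraphs on vertices of `s` that contain `S`, have only vertices of `S` in common,
and are edge disjoint. -/
structure IsPacking (G : SimpleGraph V) (S s : Set V) {k : ℕ} (P : Fin k → G.Subgraph) : Prop where
  connected : ∀ i, (P i).Connected
  subset : ∀ i, S ⊆ (P i).verts
  verts_subset : ∀ i, (P i).verts ⊆ s
  inter_subset : ∀ i j, i ≠ j → (P i).verts ∩ (P j).verts ⊆ S
  not_adj : ∀ i j, i ≠ j → ∀ u v, (P i).Adj u v → ¬(P j).Adj u v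

/-- Add one more subgraph to a packing. -/
theorem IsPacking.cons {G : SimpleGraph V} {S s : Set V} {k : ℕ} {P : Fin k → G.Subgraph}
    (h : G.IsPacking S s P) {H : G.Subgraph} (hc : H.Connected) (hS : S ⊆ H.verts)
    (hs : H.verts ⊆ s) (hi : ∀ i, H.verts ∩ (P i).verts ⊆ S)
    (hadj : ∀ i u v, H.Adj u v → ¬(P i).Adj u v) :
    G.IsPacking S s (Fin.cons H P : Fin (k + 1) → G.Subgraph) where
  connected i := by
    cases i using Fin.cases with
    | zero => exact hc
    | succ i => exact h.connected i
  subset i := by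
    cases i using Fin.cases with
    | zero => exact hS
    | succ i => exact h.subset i
  verts_subset i := by
    cases i using Fin.cases with
    | zero => exact hs
    | succ i => exact h.verts_subset i
  inter_subset i j hij := by
    cases i using Fin.cases with
    | zero =>
      cases j using Fin.cases with
      | zero => exact absurd rfl hij
      | succ j => exact hi j
    | succ i =>
      cases j using Fin.cases with
      | zero =>
        rw [Set.inter_comm]
        exact hi i
      | succ j => exact h.inter_subset i j fun h => hij (by rw [h])
  not_adj i j hij u v hu hv := by
    cases i using Fin.cases with
    | zero =>
      cases j using Fin.cases with
      | zero => exact absurd rfl hij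
      | succ j => exact hadj j u v hu hv
    | succ i =>
      cases j using Fin.cases with
      | zero => exact hadj i u v hv hu
      | succ j => exact h.not_adj i j (fun h => hij (by rw [h])) u v hu hv

/-- An edge of `G`, as a subgraph, glued to a connected subgraph at one of its ends. -/
theorem Subgraph.Connected.sup_subgraphOfAdj {G : SimpleGraph V} {H : G.Subgraph}
    (hH : H.Connected) {u v : V} (huv : G.Adj u v) (h : u ∈ H.verts ∨ v ∈ H.verts) :
    (H ⊔ G.subgraphOfAdj huv).Connected := by
  refine Subgraph.connected_sup hH.preconnected
    (Subgraph.subgraphOfAdj_connected huv).preconnected ?_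
  rcases h with h | h
  · exact ⟨u, h, by simp⟩
  · exact ⟨v, h, by simp⟩

/-- Each linking set is completed by one edge to `x` and one to `y`. The distinguished vertex `w i`
is the chosen neighbour of `x`. Every edge used has an end in its linking set, so the edge `xy`
remains free for one further subgraph. -/
theorem exists_isPacking_pair_of_linked {G : SimpleGraph V} {s : Set V} {x y : V} {k : ℕ}
    (hx : x ∈ s) (hy : y ∈ s)
    (h : (G.within (s \ {x, y})).Linked {v ∈ s | G.Adj x v ∧ v ≠ y} {v ∈ s | G.Adj y v ∧ v ≠ x}
      k) :
    ∃ (P : Fin k → G.Subgraph) (w : Fin k → V), G.IsPacking {x, y} s P ∧ Function.Injective w ∧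
      (∀ i, w i ∈ (P i).verts ∧ w i ≠ x ∧ w i ≠ y) ∧ ∀ i, ¬(P i).Adj x y := by
  obtain ⟨F, hF, hd⟩ := h
  choose hc hA hB using hF
  choose a haF haA using hA
  choose b hbF hbB using hB
  have hFs : ∀ i, F i ⊆ s \ {x, y} := fun i =>
    subset_of_within_connected (hc i) (haF i)
      ⟨(haA i).1, by
        have h1 := (haA i).2.1.ne'
        have h2 := (haA i).2.2
        simp [h1, h2]⟩
  have hxF : ∀ i, x ∉ F i := fun i hi => (hFs i hi).2 (by simp)
  have hyF : ∀ i, y ∉ F i := fun i hi => (hFs i hi).2 (by simp)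
  have hmem : ∀ i j v, v ∈ F i → v ∈ F j → i = j := by
    intro i j v hi hj
    by_contra hij
    exact Set.disjoint_left.1 (hd hij) hi hj
  let P : Fin k → G.Subgraph := fun i =>
    ((⊤ : G.Subgraph).induce (F i) ⊔ G.subgraphOfAdj (haA i).2.1) ⊔ G.subgraphOfAdj (hbB i).2.1
  have hverts : ∀ i v, v ∈ (P i).verts ↔ v ∈ F i ∨ v = x ∨ v = y := by
    intro i v
    have h1 := haF i
    have h2 := hbF i
    simp only [P, Subgraph.verts_sup, Subgraph.induce_verts, subgraphOfAdj_verts, Set.mem_union,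
      Set.mem_insert_iff, Set.mem_singleton_iff]
    grind
  have hadj : ∀ i u v, (P i).Adj u v → u ∈ F i ∨ v ∈ F i := by
    intro i u v
    have h1 := haF i
    have h2 := hbF i
    simp only [P, Subgraph.sup_adj, Subgraph.induce_adj, subgraphOfAdj_adj, Sym2.eq_iff]
    grind
  refine ⟨P, a, ⟨fun i => ?_, fun i => ?_, fun i v hv => ?_, fun i j hij v hv => ?_,
    fun i j hij u v hu hv => ?_⟩, ?_, fun i => ⟨?_, ?_, ?_⟩, fun i hi => ?_⟩
  · have h1 : ((⊤ : G.Subgraph).induce (F i)).Connected :=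
      connected_induce_iff.1 ((hc i).mono fun _ _ h => G.within_le _ h)
    exact (h1.sup_subgraphOfAdj _ (Or.inr (haF i))).sup_subgraphOfAdj _
      (Or.inr (Or.inl (hbF i)))
  · rintro v (rfl | rfl)
    · simp [hverts]
    · simp [hverts]
  · rcases (hverts i v).1 hv with hv | rfl | rfl
    exacts [(hFs i hv).1, hx, hy]
  · rcases (hverts i v).1 hv.1 with h1 | h1
    · rcases (hverts j v).1 hv.2 with h2 | h2
      · exact absurd (hmem i j v h1 h2) hij
      · exact h2
    · exact h1
  · have key : ∀ t, t ∈ F i → t ∈ (P j).verts → False := by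
      intro t ht ht'
      rcases (hverts j t).1 ht' with h | rfl | rfl
      · exact hij (hmem i j t ht h)
      · exact hxF i ht
      · exact hyF i ht
    rcases hadj i u v hu with h | h
    · exact key u h hv.fst_mem
    · exact key v h hv.snd_mem
  · intro i j hij
    exact hmem i j (a i) (haF i) (hij ▸ haF j)
  · exact (hverts i _).2 (Or.inl (haF i))
  · exact (haA i).2.1.ne'
  · exact (haA i).2.2
  · rcases hadj i x y hi with h | h
    exacts [hxF i h, hyF i h]

/-- **Menger's theorem** for two vertices, with a distinguished vertex on each path. -/
theorem ConnectedOn.exists_isPacking_pair [Finite V] {G : SimpleGraph V} {s : Set V} {k : ℕ}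
    (hs : G.ConnectedOn k s) {x y : V} (hx : x ∈ s) (hy : y ∈ s) (hxy : x ≠ y)
    (hdeg : k ≤ {v ∈ s | G.Adj x v}.ncard) :
    ∃ (P : Fin k → G.Subgraph) (w : Fin k → V), G.IsPacking {x, y} s P ∧ Function.Injective w ∧
      ∀ i, w i ∈ (P i).verts := by
  by_cases hadj : G.Adj x y
  swap
  · have hlink : (G.within (s \ {x, y})).Linked {v ∈ s | G.Adj x v ∧ v ≠ y}
        {v ∈ s | G.Adj y v ∧ v ≠ x} k := by
      refine linked_of_forall_isSeparation _ _ _ _ fun T Z hTZ => ?_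
      by_contra! hZ
      -- `Z` may contain `x` or `y`, which are isolated in the restricted graph; they are taken out
      -- so that both survive the deletion.
      have hZ' : (Z \ {x, y}).ncard < k :=
        (Set.ncard_le_ncard Set.sdiff_subset).trans_lt hZ
      have hsub := subset_of_induce_preconnected (T := insert x (T \ {y}))
        (hs _ hZ').preconnected (a := x) ⟨hx, by simp⟩ (Or.inl rfl) ?_
      · have := hsub (a := y) ⟨hy, by simp⟩
        simp [hxy.symm] at this
      · intro p hp hpT q hq hpq
        by_cases hqx : q = x
        · exact Or.inl hqx
        refine Or.inr ?_
        have hqZ : q ≠ y → q ∉ Z := fun hqy hqZ => hq.2 ⟨hqZ, by simp [hqx, hqy]⟩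
        rcases hpT with rfl | hpT
        · have hqy : q ≠ y := fun h => hadj (h ▸ hpq)
          exact ⟨(hTZ.subset ⟨hq.1, hpq, hqy⟩).resolve_right (hqZ hqy), hqy⟩
        · have hpy : p ≠ y := fun h => hpT.2 h
          by_cases hpx : p = x
          · subst hpx
            have hqy : q ≠ y := fun h => hadj (h ▸ hpq)
            exact ⟨(hTZ.subset ⟨hq.1, hpq, hqy⟩).resolve_right (hqZ hqy), hqy⟩
          have hqy : q ≠ y := by
            rintro rfl
            exact Set.disjoint_left.1 hTZ.disjoint hpT.1 ⟨hp.1, hpq.symm, hpx⟩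
          exact ⟨(hTZ.closed p hpT.1 q ⟨hpq, ⟨hp.1, by simp [hpx, hpy]⟩,
            ⟨hq.1, by simp [hqx, hqy]⟩⟩).resolve_right (hqZ hqy), hqy⟩
    obtain ⟨P, w, hP, hw, hwP, -⟩ := exists_isPacking_pair_of_linked hx hy hlink
    exact ⟨P, w, hP, hw, fun i => (hwP i).1⟩
  cases k with
  | zero =>
    exact ⟨Fin.elim0, Fin.elim0, ⟨fun i => i.elim0, fun i => i.elim0, fun i => i.elim0,
      fun i => i.elim0, fun i => i.elim0⟩, fun i => i.elim0, fun i => i.elim0⟩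
  | succ r =>
    have hA : r ≤ {v ∈ s | G.Adj x v ∧ v ≠ y}.ncard := by
      have : {v ∈ s | G.Adj x v ∧ v ≠ y} = {v ∈ s | G.Adj x v} \ {y} := by
        ext v
        simp only [Set.mem_ofPred_eq, Set.mem_sdiff, Set.mem_singleton_iff, and_assoc]
      rw [this, Set.ncard_sdiff_singleton_of_mem (show y ∈ {v ∈ s | G.Adj x v} from ⟨hy, hadj⟩)]
      omega
    have hlink : (G.within (s \ {x, y})).Linked {v ∈ s | G.Adj x v ∧ v ≠ y}
        {v ∈ s | G.Adj y v ∧ v ≠ x} r := by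
      refine linked_of_forall_isSeparation _ _ _ _ fun T Z hTZ => ?_
      by_contra! hZ
      obtain ⟨a, ha, haZ⟩ := Set.exists_mem_notMem_of_ncard_lt_ncard (hZ.trans_le hA)
      -- The edge `xy` is to be one of the `r + 1` connections, so only `r` others are needed. This
      -- leaves room to delete `x` too, which blocks the shortcut to `y`.
      have hZ' : (insert x (Z \ {y})).ncard < r + 1 :=
        (Set.ncard_insert_le _ _).trans_lt
          (Nat.succ_lt_succ ((Set.ncard_le_ncard Set.sdiff_subset).trans_lt hZ))
      have hsub := subset_of_induce_preconnected (T := T \ {y})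
        (hs _ hZ').preconnected (a := a) ⟨ha.1, ?_⟩ ?_ ?_
      · have := hsub (a := y) ⟨hy, by simp [hxy.symm]⟩
        exact this.2 rfl
      · rintro (h | h)
        · exact ha.2.1.ne' h
        · exact haZ h.1
      · exact ⟨(hTZ.subset ha).resolve_right haZ, ha.2.2⟩
      · intro p hp hpT q hq hpq
        have hpx : p ≠ x := fun h => hp.2 (Or.inl h)
        have hqx : q ≠ x := fun h => hq.2 (Or.inl h)
        have hpy : p ≠ y := fun h => hpT.2 h
        have hqy : q ≠ y := by
          rintro rfl
          exact Set.disjoint_left.1 hTZ.disjoint hpT.1 ⟨hp.1, hpq.symm, hpx⟩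
        have hqZ : q ∉ Z := fun hqZ => hq.2 (Or.inr ⟨hqZ, hqy⟩)
        exact ⟨(hTZ.closed p hpT.1 q ⟨hpq, ⟨hp.1, by simp [hpx, hpy]⟩,
          ⟨hq.1, by simp [hqx, hqy]⟩⟩).resolve_right hqZ, hqy⟩
    obtain ⟨P, w, hP, hw, hwP, hnot⟩ := exists_isPacking_pair_of_linked hx hy hlink
    -- The single edge has no inner vertex, so its distinguished vertex is `x`, which none of the
    -- others uses.
    refine ⟨Fin.cons (G.subgraphOfAdj hadj) P, Fin.cons x w,
      hP.cons (Subgraph.subgraphOfAdj_connected hadj) (by simp) ?_ ?_ ?_, ?_, ?_⟩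
    · simp [Set.insert_subset_iff, hx, hy]
    · intro i v hv
      simpa using hv.1
    · intro i u v huv huv'
      rw [subgraphOfAdj_adj, Sym2.eq_iff] at huv
      rcases huv with ⟨rfl, rfl⟩ | ⟨rfl, rfl⟩
      · exact hnot i huv'
      · exact hnot i huv'.symm
    · rw [Fin.cons_injective_iff]
      exact ⟨fun ⟨i, hi⟩ => (hwP i).2.1 hi, hw⟩
    · intro i
      cases i using Fin.cases with
      | zero => simp
      | succ i => exact (hwP i).1

/-- Extend a packing around `{x, y}` to one around `{x, y, z}` by means of exits from its members
into a highly connected set that contains `z`. -/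
theorem IsPacking.exists_insert [Finite V] {G : SimpleGraph V} {x y z : V} {A O : Set V} {k : ℕ}
    {P : Fin k → G.Subgraph} (hP : G.IsPacking {x, y} A P) (hAO : Disjoint A O)
    (hO : G.ConnectedOn k O) (hz : z ∈ O) (hdeg : k ≤ {v ∈ O | G.Adj z v}.ncard + 1)
    {w u : Fin k → V} (hwP : ∀ i, w i ∈ (P i).verts) (hw : Function.Injective w)
    (hu : Function.Injective u) (huO : ∀ i, u i ∈ O) (hwu : ∀ i, G.Adj (w i) (u i)) :
    ∃ Q : Fin k → G.Subgraph, G.IsPacking {x, y, z} (A ∪ O) Q := by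
  obtain ⟨F, hF, hFi⟩ := hO.exists_fan hz hdeg hu huO
  have hdis : ∀ v, v ∈ A → v ∈ O → False := fun v h1 h2 => Set.disjoint_left.1 hAO h1 h2
  let Q : Fin k → G.Subgraph := fun i =>
    (P i ⊔ G.subgraphOfAdj (hwu i)) ⊔ (⊤ : G.Subgraph).induce (F i)
  have hverts : ∀ i v, v ∈ (Q i).verts ↔ v ∈ (P i).verts ∨ v ∈ F i := by
    intro i v
    have h1 := hwP i
    have h2 := (hF i).2.1
    simp only [Q, Subgraph.verts_sup, Subgraph.induce_verts, subgraphOfAdj_verts, Set.mem_union,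
      Set.mem_insert_iff, Set.mem_singleton_iff]
    grind
  have hadj : ∀ i a b, (Q i).Adj a b → (P i).Adj a b ∨ (a ∈ F i ∧ b ∈ F i ∧ a ≠ b) ∨
      (a = w i ∧ b = u i) ∨ (a = u i ∧ b = w i) := by
    intro i a b
    simp only [Q, Subgraph.sup_adj, Subgraph.induce_adj, subgraphOfAdj_adj, Sym2.eq_iff]
    rintro ((h | h) | h)
    · exact Or.inl h
    · grind
    · exact Or.inr (Or.inl ⟨h.1, h.2.1, h.2.2.ne⟩)
  have hPA : ∀ i v, v ∈ (P i).verts → v ∈ A := fun i v hv => hP.verts_subset i hv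
  have hFO : ∀ i v, v ∈ F i → v ∈ O := fun i v hv => (hF i).2.2.1 hv
  refine ⟨Q, fun i => ?_, fun i v hv => ?_, fun i v hv => ?_, fun i j hij v hv => ?_,
    fun i j hij a b ha hb => ?_⟩
  · refine Subgraph.connected_sup
      ((hP.connected i).sup_subgraphOfAdj (hwu i) (Or.inl (hwP i))).preconnected
      (connected_induce_iff.1 (hF i).2.2.2).preconnected ⟨u i, ?_, ?_⟩
    · simp
    · exact (hF i).2.1
  · rw [hverts]
    rcases hv with rfl | rfl | rfl
    · exact Or.inl (hP.subset i (by simp))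
    · exact Or.inl (hP.subset i (by simp))
    · exact Or.inr (hF i).1
  · exact ((hverts i v).1 hv).imp (hPA i v) (hFO i v)
  · rcases (hverts i v).1 hv.1 with h1 | h1 <;> rcases (hverts j v).1 hv.2 with h2 | h2
    · rcases hP.inter_subset i j hij ⟨h1, h2⟩ with h | h
      · exact Or.inl h
      · exact Or.inr (Or.inl h)
    · exact (hdis v (hPA i v h1) (hFO j v h2)).elim
    · exact (hdis v (hPA j v h2) (hFO i v h1)).elim
    · exact Or.inr (Or.inr (hFi i j hij ⟨h1, h2⟩))
  · have hwA : ∀ i, w i ∈ A := fun i => hPA i _ (hwP i)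
    rcases hadj i a b ha with h1 | h1 | h1 | h1 <;> rcases hadj j a b hb with h2 | h2 | h2 | h2
    · exact hP.not_adj i j hij a b h1 h2
    · exact hdis a (hPA i a h1.fst_mem) (hFO j a h2.1)
    · exact hdis b (hPA i b h1.snd_mem) (h2.2 ▸ huO j)
    · exact hdis a (hPA i a h1.fst_mem) (h2.1 ▸ huO j)
    · exact hdis a (hPA j a h2.fst_mem) (hFO i a h1.1)
    · have e1 := hFi i j hij ⟨h1.1, h2.1⟩
      have e2 := hFi i j hij ⟨h1.2.1, h2.2.1⟩
      exact h1.2.2 (e1.trans e2.symm)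
    · exact hdis a (h2.1 ▸ hwA j) (hFO i a h1.1)
    · exact hdis b (h2.2 ▸ hwA j) (hFO i b h1.2.1)
    · exact hdis b (hPA j b h2.snd_mem) (h1.2 ▸ huO i)
    · exact hdis a (h1.1 ▸ hwA i) (hFO j a h2.1)
    · exact hij (hw (h1.1.symm.trans h2.1))
    · exact hdis a (h1.1 ▸ hwA i) (h2.1 ▸ huO j)
    · exact hdis a (hPA j a h2.fst_mem) (h1.1 ▸ huO i)
    · exact hdis b (h1.2 ▸ hwA i) (hFO j b h2.2.1)
    · exact hdis a (h2.1 ▸ hwA j) (h1.1 ▸ huO i)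
    · exact hij (hw (h1.2.symm.trans h2.2))

end SimpleGraph

/-! ### Layered sets of vertices -/

namespace SimpleGraph

variable {V : Type*}

/-- The vertices of `s` with label `c`. -/
def slice (s : Set V) (lab : V → ℤ) (c : ℤ) : Set V := {v ∈ s | lab v = c}

/-- A part `s` of `G` that is divided into highly connected slices by a labelling of its vertices
with nonzero integers, with an involution `ext` that joins each vertex to another slice, in such a
way that any two slices whose labels are not opposite are joined by at least `k` edges. -/
structure IsLayered (G : SimpleGraph V) (s : Set V) (k : ℕ) (lab : V → ℤ) (ext : V → V) :
    Prop where
  ext_mem : ∀ x ∈ s, ext x ∈ s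
  ext_ext : ∀ x ∈ s, ext (ext x) = x
  adj_ext : ∀ x ∈ s, G.Adj x (ext x)
  lab_ne_zero : ∀ x ∈ s, lab x ≠ 0
  lab_ext_ne : ∀ x ∈ s, lab (ext x) ≠ lab x
  lab_ext_ne_neg : ∀ x ∈ s, lab (ext x) ≠ -lab x
  inj : ∀ x ∈ s, ∀ y ∈ slice s lab (lab x), ∀ z ∈ slice s lab (lab x), (y = x ∨ G.Adj x y) →
    (z = x ∨ G.Adj x z) → lab (ext y) = lab (ext z) → y = z
  exists_neg : ∀ x ∈ s, ∃ y ∈ s, lab y = -lab x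
  le_edges : ∀ x ∈ s, ∀ y ∈ s, lab x ≠ lab y → lab x ≠ -lab y →
    k ≤ {v ∈ s | lab v = lab x ∧ lab (ext v) = lab y}.ncard
  conn : ∀ x ∈ s, G.ConnectedOn k (slice s lab (lab x))
  le_degree : ∀ x ∈ s, k ≤ {v ∈ slice s lab (lab x) | G.Adj x v}.ncard

/-- Around any three vertices of `s` there is a packing of `k` subgraphs. -/
def TriplePacked (G : SimpleGraph V) (k : ℕ) (s : Set V) : Prop :=
  ∀ x ∈ s, ∀ y ∈ s, ∀ z ∈ s, x ≠ y → x ≠ z → y ≠ z →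
    ∃ P : Fin k → G.Subgraph, G.IsPacking {x, y, z} s P

namespace IsLayered

variable {G : SimpleGraph V} {s : Set V} {k : ℕ} {lab : V → ℤ} {ext : V → V}

theorem ext_injOn (h : G.IsLayered s k lab ext) : Set.InjOn ext s := fun a ha b hb hab => by
  rw [← h.ext_ext a ha, hab, h.ext_ext b hb]

variable [Finite V]

/-- A vertex of `D` spoils at most one of the `k` or more edges between the two slices. The map in
the proof sends it to the end of that edge in the slice of `x`. -/
theorem exists_exit (h : G.IsLayered s k lab ext) {x y : V} (hx : x ∈ s) (hy : y ∈ s)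
    (hxy : lab x ≠ lab y) (hxy' : lab x ≠ -lab y) {D : Set V} (hD : D.ncard < k) :
    ∃ v ∈ s, lab v = lab x ∧ lab (ext v) = lab y ∧ v ∉ D ∧ ext v ∉ D := by
  classical
  obtain ⟨v, ⟨hv, hvx, hvy⟩, hvD⟩ := Set.exists_mem_notMem_of_ncard_lt_ncard
    (((Set.ncard_image_le (f := fun v => if lab v = lab x then v else ext v) D.toFinite).trans_lt
      hD).trans_le (h.le_edges x hx y hy hxy hxy'))
  refine ⟨v, hv, hvx, hvy, fun hmem => hvD ⟨v, hmem, by simp [hvx]⟩,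
    fun hmem => hvD ⟨ext v, hmem, ?_⟩⟩
  have : lab (ext v) ≠ lab x := fun h => hxy (h.symm.trans hvy)
  simp [this, h.ext_ext v hv]

/-- A union of slices is highly connected if it contains the slice opposite to a missing one. -/
theorem connectedOn_of_neg_mem (h : G.IsLayered s k lab ext) {p : V} (hp : p ∈ s) {I : Set ℤ}
    (hpI : lab p ∉ I) (hpI' : -lab p ∈ I) : G.ConnectedOn k {v ∈ s | lab v ∈ I} := by
  intro D hD
  obtain ⟨q, hq, hqp⟩ := h.exists_neg p hp
  obtain ⟨⟨b, hb⟩⟩ := (h.conn q hq D hD).nonempty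
  have hslice : ∀ x ∈ s, ∀ T : Set V, lab x ∈ I →
      (∀ u ∈ {v ∈ s | lab v ∈ I} \ D, u ∈ T → ∀ v ∈ {v ∈ s | lab v ∈ I} \ D, G.Adj u v → v ∈ T) →
      ∀ a, a ∈ slice s lab (lab x) → a ∉ D → a ∈ T → slice s lab (lab x) \ D ⊆ T := by
    intro x hx T hxI hT a ha haD haT
    refine subset_of_induce_preconnected (h.conn x hx D hD).preconnected ⟨ha, haD⟩ haT ?_
    rintro u ⟨⟨hus, hu⟩, huD⟩ huT v ⟨⟨hvs, hv⟩, hvD⟩ huv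
    exact hT u ⟨⟨hus, hu ▸ hxI⟩, huD⟩ huT v ⟨⟨hvs, hv ▸ hxI⟩, hvD⟩ huv
  have hqI : lab q ∈ I := hqp ▸ hpI'
  refine induce_connected_of_forall_subset (a := b) ⟨⟨hb.1.1, hb.1.2 ▸ hqI⟩, hb.2⟩ ?_
  intro T hbT hT
  have hqT := hslice q hq T hqI hT b hb.1 hb.2 hbT
  rintro v ⟨⟨hv, hvI⟩, hvD⟩
  by_cases hvq : lab v = lab q
  · exact hqT ⟨⟨hv, hvq⟩, hvD⟩
  -- The only label opposite to that of `q` is `lab p`, which is not in `I`. So the slice of `q` is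
  -- joined directly to every other slice of the union.
  have hvp : lab q ≠ -lab v := by
    intro hne
    refine hpI ?_
    have : lab p = lab v := by omega
    rwa [this]
  obtain ⟨e, he, heq, hev, heD, heD'⟩ := h.exists_exit hq hv (Ne.symm hvq) hvp hD
  have heT : e ∈ T := hqT ⟨⟨he, heq⟩, heD⟩
  have hes : ext e ∈ s := h.ext_mem e he
  refine hslice v hv T hvI hT (ext e) ⟨hes, hev⟩ heD'
    (hT e ⟨⟨he, by rwa [heq]⟩, heD⟩ heT (ext e) ⟨⟨hes, by rwa [hev]⟩, heD'⟩ (h.adj_ext e he))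
    ⟨⟨hv, rfl⟩, hvD⟩

/-- If possible, `p` is taken in `D`, so that fewer than `k` deleted vertices lie outside its slice
and the other slices stay connected together. The slice of `p` either loses fewer than `k` vertices,
and then hangs on by one exit, or contains all of `D`, and then each remaining vertex `v` hangs on
by `ext v`. -/
theorem connectedOn_succ (h : G.IsLayered s k lab ext) (hk : 1 ≤ k) (hs : s.Nonempty) :
    G.ConnectedOn (k + 1) s := by
  intro D hD
  obtain ⟨p, hp, hpD⟩ : ∃ p ∈ s, ((D ∩ s) \ {p}).ncard < k := by
    have hle : (D ∩ s).ncard ≤ D.ncard := Set.ncard_le_ncard Set.inter_subset_left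
    by_cases hDs : (D ∩ s).Nonempty
    · obtain ⟨p, hp⟩ := hDs
      refine ⟨p, hp.2, ?_⟩
      have := Set.ncard_sdiff_singleton_lt_of_mem hp
      omega
    · obtain ⟨p, hp⟩ := hs
      refine ⟨p, hp, ?_⟩
      rw [Set.not_nonempty_iff_eq_empty.1 hDs]
      simpa using Nat.lt_of_lt_of_le Nat.zero_lt_one hk
  have hDmem : ∀ v ∈ s, v ≠ p → v ∈ D → v ∈ (D ∩ s) \ {p} := fun v hv hvp hvD =>
    ⟨⟨hvD, hv⟩, hvp⟩
  have hOc := h.connectedOn_of_neg_mem hp (I := {c | c ≠ lab p}) (by simp)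
    (by
      have := h.lab_ne_zero p hp
      change -lab p ≠ lab p
      omega) _ hpD
  -- Aiming at the label opposite to that of `ext p` ensures that the exit found is not the edge at
  -- `p`, which may be deleted.
  obtain ⟨y, hy, hyp⟩ := h.exists_neg _ (h.ext_mem p hp)
  have h1 := h.lab_ext_ne p hp
  have h2 := h.lab_ext_ne_neg p hp
  have h3 := h.lab_ne_zero _ (h.ext_mem p hp)
  obtain ⟨e, he, hep, hey, heD, heD'⟩ := h.exists_exit hp hy (by omega) (by omega) hpD
  have hes := h.ext_mem e he
  have hne : e ≠ p := by
    rintro rfl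
    omega
  have hne' : ext e ≠ p := by
    intro hcon
    rw [hcon] at hey
    omega
  have heD₁ : e ∉ D := fun hmem => heD (hDmem e he hne hmem)
  have heD₁' : ext e ∉ D := fun hmem => heD' (hDmem _ hes hne' hmem)
  have hextO : ∀ v ∈ s, lab v = lab p → lab (ext v) ≠ lab p := fun v hv hvp =>
    hvp ▸ h.lab_ext_ne v hv
  refine induce_connected_of_forall_subset (a := ext e) ⟨hes, heD₁'⟩ fun T heT hT => ?_
  have hOT : ∀ v ∈ s, lab v ≠ lab p → v ∉ D → v ∈ T := by
    intro v hv hvp hvD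
    refine subset_of_induce_preconnected hOc.preconnected ⟨⟨hes, hextO e he hep⟩, heD'⟩ heT ?_
      ⟨⟨hv, hvp⟩, fun hmem => hvD hmem.1.1⟩
    have hmem : ∀ u ∈ {v ∈ s | lab v ∈ {c | c ≠ lab p}} \ ((D ∩ s) \ {p}), u ∈ s \ D := by
      rintro u ⟨⟨hu, hup⟩, huD⟩
      exact ⟨hu, fun hmem => huD (hDmem u hu (fun h => hup (h ▸ rfl)) hmem)⟩
    exact fun u hu huT v hv huv => hT u (hmem u hu) huT v (hmem v hv) huv
  rintro v ⟨hv, hvD⟩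
  by_cases hvp : lab v = lab p
  swap
  · exact hOT v hv hvp hvD
  by_cases hDk : (D ∩ slice s lab (lab p)).ncard < k
  · refine subset_of_induce_preconnected (h.conn p hp _ hDk).preconnected (a := e)
      ⟨⟨he, hep⟩, fun hmem => heD₁ hmem.1⟩ (hT (ext e) ⟨hes, heD₁'⟩ heT e ⟨he, heD₁⟩
        (h.adj_ext e he).symm) ?_ ⟨⟨hv, hvp⟩, fun hmem => hvD hmem.1⟩
    have hmem : ∀ u ∈ slice s lab (lab p) \ (D ∩ slice s lab (lab p)), u ∈ s \ D :=
      fun u hu => ⟨hu.1.1, fun hmem => hu.2 ⟨hmem, hu.1⟩⟩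
    exact fun u hu huT v hv huv => hT u (hmem u hu) huT v (hmem v hv) huv
  · have hDeq : D ∩ slice s lab (lab p) = D :=
      Set.eq_of_subset_of_ncard_le Set.inter_subset_left (by omega)
    have hvD' : ext v ∉ D := fun hmem => hextO v hv hvp (hDeq ▸ hmem : _ ∈ D ∩ _).2.2
    exact hT (ext v) ⟨h.ext_mem v hv, hvD'⟩
      (hOT _ (h.ext_mem v hv) (hextO v hv hvp) hvD') v ⟨hv, hvD⟩ (h.adj_ext v hv).symm

/-- Disjoint connections between two slices, each with an exit to a third slice. -/
theorem exists_isPacking_pair (h : G.IsLayered s k lab ext) (hk : 1 ≤ k) {x y : V} (hx : x ∈ s)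
    (hy : y ∈ s) (hxy : lab x ≠ lab y) (hxy' : lab x ≠ -lab y) :
    ∃ (P : Fin k → G.Subgraph) (w : Fin k → V),
      G.IsPacking {x, y} {v ∈ s | lab v = lab x ∨ lab v = lab y} P ∧ Function.Injective w ∧
      ∀ i, w i ∈ (P i).verts ∧ lab (ext (w i)) ≠ lab x ∧ lab (ext (w i)) ≠ lab y := by
  classical
  obtain ⟨e, he⟩ : ∃ e : Fin k → V, Function.Injective e ∧
      ∀ i, e i ∈ s ∧ lab (e i) = lab x ∧ lab (ext (e i)) = lab y := by
    let E := {v ∈ s | lab v = lab x ∧ lab (ext v) = lab y}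
    let f : Fin E.ncard ≃ E := (Finite.equivFin E).symm
    have hle : k ≤ E.ncard := h.le_edges x hx y hy hxy hxy'
    exact ⟨fun i => f (Fin.castLE hle i),
      Subtype.val_injective.comp (f.injective.comp (Fin.castLE_injective hle)),
      fun i => (f (Fin.castLE hle i)).2⟩
  obtain ⟨hinj, he⟩ := he
  obtain ⟨y', hy', hyy'⟩ := h.exists_neg y hy
  have hy0 := h.lab_ne_zero y hy
  -- If some `e i` is `x`, its fan member could be trivial and offer no exit. It is sent to `t`
  -- instead, whose outer neighbour has label `-lab y`.
  obtain ⟨t, ht, htx, hty, -⟩ := h.exists_exit hx hy' (by omega) (by omega)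
    (D := ∅) (by simpa using Nat.lt_of_lt_of_le Nat.zero_lt_one hk)
  let τ : Fin k → V := fun i => if e i = x then t else e i
  have hτt : ∀ i, e i = x → τ i = t := fun i hi => by simp [τ, hi]
  have hτe : ∀ i, e i ≠ x → τ i = e i := fun i hi => by simp [τ, hi]
  have het : ∀ i, e i ≠ t := by
    intro i hi
    have := (he i).2.2
    rw [hi] at this
    omega
  have hτ : Function.Injective τ := by
    intro i j hij
    by_cases hi : e i = x <;> by_cases hj : e j = x
    · exact hinj (hi.trans hj.symm)
    · rw [hτt i hi, hτe j hj] at hij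
      exact absurd hij.symm (het j)
    · rw [hτe i hi, hτt j hj] at hij
      exact absurd hij (het i)
    · rw [hτe i hi, hτe j hj] at hij
      exact hinj hij
  have hτs : ∀ i, τ i ∈ slice s lab (lab x) := by
    intro i
    by_cases hi : e i = x
    · rw [hτt i hi]
      exact ⟨ht, htx⟩
    · rw [hτe i hi]
      exact ⟨(he i).1, (he i).2.1⟩
  obtain ⟨F, hF, hFi⟩ := (h.conn x hx).exists_fan ⟨hx, rfl⟩
    ((h.le_degree x hx).trans (Nat.le_succ _)) hτ hτs
  obtain ⟨F', hF', hFi'⟩ := (h.conn y hy).exists_fan (u := fun i => ext (e i)) ⟨hy, rfl⟩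
    ((h.le_degree y hy).trans (Nat.le_succ _))
    (fun i j hij => hinj (by
      rw [← h.ext_ext _ (he i).1, ← h.ext_ext _ (he j).1]
      exact congrArg ext hij))
    (fun i => ⟨h.ext_mem _ (he i).1, (he i).2.2⟩)
  have heF : ∀ i, e i ∈ F i := by
    intro i
    by_cases hi : e i = x
    · rw [hi]
      exact (hF i).1
    · have := (hF i).2.1
      rwa [hτe i hi] at this
  have hFx : ∀ i v, v ∈ F i → v ∈ s ∧ lab v = lab x := fun i v hv => (hF i).2.2.1 hv
  have hFy : ∀ i v, v ∈ F' i → v ∈ s ∧ lab v = lab y := fun i v hv => (hF' i).2.2.1 hv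
  have hadj : ∀ i, G.Adj (e i) (ext (e i)) := fun i => h.adj_ext _ (he i).1
  -- The exit is taken at a neighbour of `e i` in its fan member: by `inj`, that neighbour is joined
  -- to a slice other than that of `y`.
  have hnb : ∀ i, ∃ v ∈ F i, (e i = x → v = t) ∧ (e i ≠ x → G.Adj (e i) v) := by
    intro i
    by_cases hi : e i = x
    · refine ⟨t, ?_, fun _ => rfl, fun h => absurd hi h⟩
      rw [← hτt i hi]
      exact (hF i).2.1
    · by_contra! hcon
      have := subset_of_induce_preconnected (hF i).2.2.2.preconnected (heF i) (T := {e i}) rfl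
        (by
          rintro u - rfl v hv huv
          obtain ⟨h1, h2⟩ := hcon v hv fun h => absurd h hi
          exact absurd huv h2)
      exact hi (this (hF i).1).symm
  choose w hwF hwt hwe using hnb
  let P : Fin k → G.Subgraph := fun i =>
    ((⊤ : G.Subgraph).induce (F i) ⊔ G.subgraphOfAdj (hadj i)) ⊔ (⊤ : G.Subgraph).induce (F' i)
  have hverts : ∀ i v, v ∈ (P i).verts ↔ v ∈ F i ∨ v ∈ F' i := by
    intro i v
    have h1 := heF i
    have h2 := (hF' i).2.1
    simp only [P, Subgraph.verts_sup, Subgraph.induce_verts, subgraphOfAdj_verts, Set.mem_union,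
      Set.mem_insert_iff, Set.mem_singleton_iff]
    grind
  have hinter : ∀ i j, i ≠ j → (P i).verts ∩ (P j).verts ⊆ {x, y} := by
    rintro i j hij v ⟨hi, hj⟩
    rcases (hverts i v).1 hi with hi | hi <;> rcases (hverts j v).1 hj with hj | hj
    · exact Or.inl (hFi i j hij ⟨hi, hj⟩)
    · exact absurd ((hFx i v hi).2.symm.trans (hFy j v hj).2) hxy
    · exact absurd ((hFx j v hj).2.symm.trans (hFy i v hi).2) hxy
    · exact Or.inr (hFi' i j hij ⟨hi, hj⟩)
  have hPadj : ∀ i u v, (P i).Adj u v → lab u = lab v ∨ (e i = u ∧ ext (e i) = v) ∨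
      (e i = v ∧ ext (e i) = u) := by
    intro i u v
    simp only [P, Subgraph.sup_adj, Subgraph.induce_adj, subgraphOfAdj_adj, Sym2.eq_iff]
    rintro ((huv | huv) | huv)
    · exact Or.inl ((hFx i u huv.1).2.trans (hFx i v huv.2.1).2.symm)
    · exact Or.inr huv
    · exact Or.inl ((hFy i u huv.1).2.trans (hFy i v huv.2.1).2.symm)
  have hPxy : ∀ i, (P i).Adj x y → e i = x := by
    intro i hi
    rcases hPadj i x y hi with hl | hl | hl
    · exact absurd hl hxy
    · exact hl.1
    · exact absurd ((he i).2.1.symm.trans (congrArg lab hl.1)) hxy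
  refine ⟨P, w, ⟨fun i => ?_, fun i => ?_, fun i v hv => ?_, hinter, fun i j hij u v hu hv => ?_⟩,
    fun i j hij => ?_, fun i => ⟨(hverts i _).2 (Or.inl (hwF i)), ?_, ?_⟩⟩
  · refine Subgraph.connected_sup ((connected_induce_iff.1 (hF i).2.2.2).sup_subgraphOfAdj (hadj i)
      (Or.inl (heF i))).preconnected (connected_induce_iff.1 (hF' i).2.2.2).preconnected
      ⟨ext (e i), ?_, (hF' i).2.1⟩
    simp
  · rintro v (rfl | rfl)
    · exact (hverts i _).2 (Or.inl (hF i).1)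
    · exact (hverts i _).2 (Or.inr (hF' i).1)
  · rcases (hverts i v).1 hv with hv | hv
    · exact ⟨(hFx i v hv).1, Or.inl (hFx i v hv).2⟩
    · exact ⟨(hFy i v hv).1, Or.inr (hFy i v hv).2⟩
  -- A shared edge has both ends in `{x, y}`, and the edge `xy` is used only by the index with `e i
  -- = x`.
  · have hne := hu.ne
    rcases hinter i j hij ⟨hu.fst_mem, hv.fst_mem⟩ with rfl | rfl <;>
      rcases hinter i j hij ⟨hu.snd_mem, hv.snd_mem⟩ with rfl | rfl
    · exact hne rfl
    · exact hij (hinj ((hPxy i hu).trans (hPxy j hv).symm))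
    · exact hij (hinj ((hPxy i hu.symm).trans (hPxy j hv.symm).symm))
    · exact hne rfl
  -- Fan members meet only in `x`, so both `e i` and `e j` are neighbours of `x` joined to the slice
  -- of `y`; `inj` at `x` identifies them.
  · by_contra hne
    have hwi : w i = x := hFi i j hne ⟨hwF i, hij ▸ hwF j⟩
    have hwj : w j = x := hij ▸ hwi
    have hnx : ∀ i, w i = x → e i ≠ x := by
      intro i hi hei
      have h1 := hwt i hei
      have h2 := (he i).2.2
      rw [hei, ← hi, h1] at h2
      omega
    have hi := hwe i (hnx i hwi)
    have hj := hwe j (hnx j hwj)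
    rw [hwi] at hi
    rw [hwj] at hj
    exact hne (hinj (h.inj x hx (e i) ⟨(he i).1, (he i).2.1⟩ (e j) ⟨(he j).1, (he j).2.1⟩
      (Or.inr hi.symm) (Or.inr hj.symm) ((he i).2.2.trans (he j).2.2.symm)))
  · have := h.lab_ext_ne _ (hFx i _ (hwF i)).1
    rwa [(hFx i _ (hwF i)).2] at this
  · by_cases hi : e i = x
    · rw [hwt i hi]
      omega
    · intro hcon
      have hwi := hwe i hi
      refine hwi.ne (h.inj (e i) (he i).1 (e i) ⟨(he i).1, rfl⟩ (w i)
        ⟨(hFx i _ (hwF i)).1, (hFx i _ (hwF i)).2.trans (he i).2.1.symm⟩ (Or.inl rfl)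
        (Or.inr hwi) ((he i).2.2.trans hcon.symm))

/-- Extend a packing around `{x, y}` in a union of slices to one around `{x, y, z}`. -/
theorem exists_isPacking_insert (h : G.IsLayered s k lab ext) {x y z p : V} (hp : p ∈ s)
    {I : Set ℤ} (hpI : lab p ∈ I) (hpI' : -lab p ∉ I) (hz : z ∈ s) (hzI : lab z ∉ I)
    {P : Fin k → G.Subgraph} (hP : G.IsPacking {x, y} {v ∈ s | lab v ∈ I} P) {w : Fin k → V}
    (hw : Function.Injective w) (hwP : ∀ i, w i ∈ (P i).verts)
    (hwI : ∀ i, lab (ext (w i)) ∉ I) :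
    ∃ Q : Fin k → G.Subgraph, G.IsPacking {x, y, z} s Q := by
  have hws : ∀ i, w i ∈ s := fun i => (hP.verts_subset i (hwP i)).1
  obtain ⟨Q, hQ⟩ := hP.exists_insert (O := {v ∈ s | lab v ∈ Iᶜ}) (z := z)
    (Set.disjoint_left.2 fun v hv hv' => hv'.2 hv.2)
    (h.connectedOn_of_neg_mem hp (I := Iᶜ) (fun hn => hn hpI) hpI') ⟨hz, hzI⟩
    (((h.le_degree z hz).trans (Set.ncard_le_ncard (by
      rintro v ⟨⟨hv, hvz⟩, hzv⟩
      exact ⟨⟨hv, show lab v ∉ I from hvz ▸ hzI⟩, hzv⟩))).trans (Nat.le_succ _)) hwP hw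
    (u := fun i => ext (w i)) (fun i j hij => hw (h.ext_injOn (hws i) (hws j) hij))
    (fun i => ⟨h.ext_mem _ (hws i), hwI i⟩) (fun i => h.adj_ext _ (hws i))
  refine ⟨Q, hQ.connected, hQ.subset, fun i v hv => ?_, hQ.inter_subset, hQ.not_adj⟩
  rcases hQ.verts_subset i hv with h | h <;> exact h.1

theorem exists_isPacking_of_lab_eq (h : G.IsLayered s k lab ext) {x y z : V} (hx : x ∈ s)
    (hy : y ∈ s) (hz : z ∈ s) (hne : x ≠ y) (hxy : lab x = lab y) (hxz : lab x ≠ lab z) :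
    ∃ Q : Fin k → G.Subgraph, G.IsPacking {x, y, z} s Q := by
  obtain ⟨P, w, hP, hw, hwP⟩ := (h.conn x hx).exists_isPacking_pair ⟨hx, rfl⟩ ⟨hy, hxy.symm⟩ hne
    (h.le_degree x hx)
  have hx0 := h.lab_ne_zero x hx
  refine h.exists_isPacking_insert hx (I := {lab x}) rfl ?_ hz (fun h => hxz h.symm) hP hw hwP ?_
  · rw [Set.mem_singleton_iff]
    omega
  · intro i
    have hwi := hP.verts_subset i (hwP i)
    have := h.lab_ext_ne _ hwi.1
    rwa [hwi.2] at this

theorem exists_isPacking_of_lab_ne (h : G.IsLayered s k lab ext) (hk : 1 ≤ k) {x y z : V}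
    (hx : x ∈ s) (hy : y ∈ s) (hz : z ∈ s) (hxy : lab x ≠ lab y) (hxy' : lab x ≠ -lab y)
    (hxz : lab x ≠ lab z) (hyz : lab y ≠ lab z) :
    ∃ Q : Fin k → G.Subgraph, G.IsPacking {x, y, z} s Q := by
  obtain ⟨P, w, hP, hw, hwP⟩ := h.exists_isPacking_pair hk hx hy hxy hxy'
  have hx0 := h.lab_ne_zero x hx
  refine h.exists_isPacking_insert hx (I := {lab x, lab y}) (by simp) ?_ hz ?_ hP hw
    (fun i => (hwP i).1) fun i => ?_
  · rintro (h | h)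
    · omega
    · have : -lab x = lab y := h
      omega
  · rintro (h | h)
    · exact hxz h.symm
    · exact hyz h.symm
  · rintro (h | h)
    · exact (hwP i).2.1 h
    · exact (hwP i).2.2 h

/-- If the three vertices lie in one slice, one more subgraph runs through the other slices. -/
theorem exists_isPacking_of_slice (h : G.IsLayered s (k + 1) lab ext) {x y z : V} (hx : x ∈ s)
    (hy : y ∈ s) (hz : z ∈ s) (hxy : lab x = lab y) (hxz : lab x = lab z)
    {P : Fin k → G.Subgraph} (hP : G.IsPacking {x, y, z} (slice s lab (lab x)) P) :
    ∃ Q : Fin (k + 1) → G.Subgraph, G.IsPacking {x, y, z} s Q := by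
  have hx0 := h.lab_ne_zero x hx
  let O : Set V := {v ∈ s | lab v ∈ {c | c ≠ lab x}}
  have hO : (G.induce O).Connected := by
    have := h.connectedOn_of_neg_mem hx (I := {c | c ≠ lab x}) (by simp)
      (by
        change -lab x ≠ lab x
        omega) ∅ (by simp)
    rwa [Set.sdiff_empty] at this
  have hext : ∀ v ∈ s, lab x = lab v → ext v ∈ O := fun v hv hvx =>
    ⟨h.ext_mem v hv, by
      change lab (ext v) ≠ lab x
      exact hvx ▸ h.lab_ext_ne v hv⟩
  have ex := hext x hx rfl
  have ey := hext y hy hxy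
  have ez := hext z hz hxz
  let H : G.Subgraph := (((⊤ : G.Subgraph).induce O ⊔ G.subgraphOfAdj (h.adj_ext x hx)) ⊔
    G.subgraphOfAdj (h.adj_ext y hy)) ⊔ G.subgraphOfAdj (h.adj_ext z hz)
  have hverts : ∀ v, v ∈ H.verts ↔ v ∈ O ∨ v = x ∨ v = y ∨ v = z := by
    intro v
    simp only [H, Subgraph.verts_sup, Subgraph.induce_verts, subgraphOfAdj_verts, Set.mem_union,
      Set.mem_insert_iff, Set.mem_singleton_iff]
    grind
  have hadj : ∀ u v, H.Adj u v → u ∈ O ∨ v ∈ O := by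
    intro u v
    simp only [H, Subgraph.sup_adj, Subgraph.induce_adj, subgraphOfAdj_adj, Sym2.eq_iff]
    grind
  have hOP : ∀ i v, v ∈ O → v ∉ (P i).verts := fun i v hv hv' => hv.2 (hP.verts_subset i hv').2
  refine ⟨Fin.cons H P, IsPacking.cons ⟨hP.connected, hP.subset,
    fun i => (hP.verts_subset i).trans fun v hv => hv.1, hP.inter_subset, hP.not_adj⟩
    ?_ ?_ ?_ ?_ ?_⟩
  · have h0 : ((⊤ : G.Subgraph).induce O).Connected := connected_induce_iff.1 hO
    have h1 := h0.sup_subgraphOfAdj (h.adj_ext x hx) (Or.inr ex)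
    have h2 := h1.sup_subgraphOfAdj (h.adj_ext y hy) (Or.inr (Or.inl ey))
    exact h2.sup_subgraphOfAdj (h.adj_ext z hz) (Or.inr (Or.inl (Or.inl ez)))
  · intro v hv
    exact (hverts v).2 (Or.inr hv)
  · intro v hv
    rcases (hverts v).1 hv with hv | rfl | rfl | rfl
    exacts [hv.1, hx, hy, hz]
  · rintro i v ⟨hv, hv'⟩
    exact ((hverts v).1 hv).resolve_left fun hO => hOP i v hO hv'
  · intro i u v huv huv'
    rcases hadj u v huv with hO | hO
    · exact hOP i u hO huv'.fst_mem
    · exact hOP i v hO huv'.snd_mem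

theorem triplePacked_succ (h : G.IsLayered s (k + 1) lab ext)
    (ih : ∀ x ∈ s, G.TriplePacked k (slice s lab (lab x))) : G.TriplePacked (k + 1) s := by
  intro x hx y hy z hz hxy hxz hyz
  have hset₁ : ({x, z, y} : Set V) = {x, y, z} := by grind
  have hset₂ : ({y, z, x} : Set V) = {x, y, z} := by grind
  by_cases h1 : lab x = lab y
  · by_cases h2 : lab x = lab z
    · obtain ⟨P, hP⟩ := ih x hx x ⟨hx, rfl⟩ y ⟨hy, h1.symm⟩ z ⟨hz, h2.symm⟩ hxy hxz hyz
      exact h.exists_isPacking_of_slice hx hy hz h1 h2 hP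
    · exact h.exists_isPacking_of_lab_eq hx hy hz hxy h1 h2
  by_cases h2 : lab x = lab z
  · rw [← hset₁]
    exact h.exists_isPacking_of_lab_eq hx hz hy hxz h2 h1
  by_cases h3 : lab y = lab z
  · rw [← hset₂]
    exact h.exists_isPacking_of_lab_eq hy hz hx hyz h3 (Ne.symm h1)
  -- With three distinct labels, `lab x` cannot be opposite to both others, so `x` and one of `y`,
  -- `z` form the required pair.
  by_cases h4 : lab x = -lab y
  · rw [← hset₁]
    exact h.exists_isPacking_of_lab_ne (Nat.le_add_left _ _) hx hz hy h2 (by omega) h1 (Ne.symm h3)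
  · exact h.exists_isPacking_of_lab_ne (Nat.le_add_left _ _) hx hy hz h1 h4 h2 h3

end IsLayered

end SimpleGraph

/-! ### From packings to trees, and the upper bound -/

namespace SimpleGraph

variable {V : Type*} {G : SimpleGraph V}

/-- A connected subgraph has a spanning tree. -/
theorem Subgraph.Connected.exists_isTree {H : G.Subgraph} (h : H.Connected) :
    ∃ T : G.Subgraph, T.coe.IsTree ∧ T.verts = H.verts ∧ ∀ u v, T.Adj u v → H.Adj u v := by
  obtain ⟨F, hFH, hF⟩ := h.coe.exists_isTree_le
  let T : G.Subgraph :=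
    { verts := H.verts
      Adj := fun u v => ∃ (hu : u ∈ H.verts) (hv : v ∈ H.verts), F.Adj ⟨u, hu⟩ ⟨v, hv⟩
      adj_sub := fun ⟨_, _, huv⟩ => (hFH huv).adj_sub
      edge_vert := fun ⟨hu, _, _⟩ => hu
      symm := ⟨fun _ _ ⟨hu, hv, huv⟩ => ⟨hv, hu, huv.symm⟩⟩ }
  have hT : T.coe = F := by
    ext u v
    exact ⟨fun ⟨_, _, huv⟩ => huv, fun huv => ⟨u.2, v.2, huv⟩⟩
  exact ⟨T, hT ▸ hF, rfl, fun u v ⟨_, _, huv⟩ => hFH huv⟩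

theorem IsPacking.le_treeConnectivity {S s : Set V} {k : ℕ} {P : Fin k → G.Subgraph}
    (h : G.IsPacking S s P) : (k : ℕ∞) ≤ G.treeConnectivity S := by
  choose T hT hTv hTa using fun i => (h.connected i).exists_isTree
  refine le_iSup₂_of_le (f := fun (r : ℕ)
    (_ : ∃ T : Fin r → G.Subgraph, G.InternallyDisjointTrees S T) => (r : ℕ∞)) k
    ⟨T, fun i => ⟨hT i, (hTv i).symm ▸ h.subset i⟩, fun i j hij => ⟨?_, ?_⟩⟩ le_rfl
  · rw [hTv, hTv]
    exact (h.inter_subset i j hij).antisymm (Set.subset_inter (h.subset i) (h.subset j))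
  · rw [Set.eq_empty_iff_forall_notMem]
    rintro e ⟨hi, hj⟩
    induction e with
    | h u v => exact h.not_adj i j hij u v (hTa i u v hi) (hTa j u v hj)

/-- Two adjacent vertices of degree at most `n` bound the number of internally edge disjoint
trees that connect them to a third vertex. -/
theorem InternallyDisjointTrees.lt_of_adj {x y z : V} {n : ℕ} (hxy : G.Adj x y) (hzx : z ≠ x)
    (hzy : z ≠ y) (hfx : (G.neighborSet x).Finite) (hfy : (G.neighborSet y).Finite)
    (hx : (G.neighborSet x).ncard ≤ n) (hy : (G.neighborSet y).ncard ≤ n) {r : ℕ}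
    {T : Fin r → G.Subgraph} (hT : G.InternallyDisjointTrees {x, y, z} T) : r < n := by
  have huniq : ∀ i j u v, (T i).Adj u v → (T j).Adj u v → i = j := by
    intro i j u v hi hj
    by_contra hij
    exact (Set.eq_empty_iff_forall_notMem.1 (hT.2 i j hij).2) s(u, v) ⟨hi, hj⟩
  have hclosed : ∀ i (W : Set V), (∀ u ∈ W, ∀ v, (T i).Adj u v → v ∈ W) →
      ∀ a ∈ W, a ∈ (T i).verts → ∀ b ∈ (T i).verts, b ∈ W := by
    intro i W hW a haW ha b hb
    exact (hT.1 i).1.connected.preconnected.mem_of_closed (T := {v | (v : V) ∈ W})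
      (fun u hu v huv => hW u hu v huv) (a := ⟨a, ha⟩) haW ⟨b, hb⟩
  have hmem : ∀ i, x ∈ (T i).verts ∧ y ∈ (T i).verts ∧ z ∈ (T i).verts := fun i =>
    ⟨(hT.1 i).2 (by simp), (hT.1 i).2 (by simp), (hT.1 i).2 (by simp)⟩
  have hnb : ∀ a, a ≠ z → (∀ i, a ∈ (T i).verts) → ∀ i, ∃ v, (T i).Adj a v := by
    intro a haz ha i
    by_contra! hcon
    refine haz (hclosed i {a} ?_ a rfl (ha i) z (hmem i).2.2).symm
    rintro u rfl v huv
    exact absurd huv (hcon v)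
  -- The trees use distinct neighbours of `a`, so `n` of them exhaust the neighbourhood.
  have hsurj : ∀ a, (G.neighborSet a).Finite → (G.neighborSet a).ncard ≤ n →
      ∀ f : Fin r → V, (∀ i, (T i).Adj a (f i)) → r ≤ n ∧
      (n ≤ r → ∀ v, G.Adj a v → ∃ i, f i = v) := by
    intro a hfin ha f hf
    have hinj : Function.Injective f := fun i j hij => huniq i j a (f i) (hf i) (hij ▸ hf j)
    have hcard : (Set.range f).ncard = r := by
      rw [← Set.image_univ, Set.ncard_image_of_injective _ hinj, Set.ncard_univ]
      simp
    have hsub : Set.range f ⊆ G.neighborSet a := by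
      rintro _ ⟨i, rfl⟩
      exact (hf i).adj_sub
    have hle := Set.ncard_le_ncard hsub hfin
    refine ⟨by omega, fun hn v hv => ?_⟩
    have := Set.eq_of_subset_of_ncard_le hsub (by omega) hfin
    have hv' : v ∈ G.neighborSet a := hv
    rwa [← this] at hv'
  choose f hf using hnb x hzx.symm fun i => (hmem i).1
  choose g hg using hnb y hzy.symm fun i => (hmem i).2.1
  obtain ⟨hle, hfs⟩ := hsurj x hfx hx f hf
  obtain ⟨-, hgs⟩ := hsurj y hfy hy g hg
  by_contra! hn
  obtain ⟨i, hi⟩ := hfs hn y hxy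
  have hixy : (T i).Adj x y := hi ▸ hf i
  obtain ⟨l, hl⟩ := hgs hn x hxy.symm
  have hli : l = i := huniq l i y x (hl ▸ hg l) hixy.symm
  subst hli
  have hz := hclosed l {x, y} ?_ x (by simp) (hmem l).1 z (hmem l).2.2
  · rcases hz with h | h
    exacts [hzx h, hzy h]
  rintro u (rfl | rfl) v huv
  · obtain ⟨j, rfl⟩ := hfs hn v huv.adj_sub
    rw [huniq j l u (f j) (hf j) huv, hi]
    simp
  · obtain ⟨j, rfl⟩ := hgs hn v huv.adj_sub
    rw [huniq j l u (g j) (hg j) huv, hl]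
    simp

end SimpleGraph

/-! ### The cells of the burnt pancake graph -/

namespace SignedPerm

variable {n : ℕ}

theorem abs_word_injective (x : SignedPerm n) : Function.Injective fun j => |x.word j| :=
  fun _ _ h => x.bijOn_abs.injOn (Set.mem_univ _) (Set.mem_univ _) h

theorem word_ne_zero (x : SignedPerm n) (j : Fin n) : x.word j ≠ 0 := by
  intro h
  have := (x.bijOn_abs.mapsTo (Set.mem_univ j)).1
  simp [h] at this

theorem eq_of_word_eq_or_eq_neg (x : SignedPerm n) {i j : Fin n}
    (h : x.word i = x.word j ∨ x.word i = -x.word j) : i = j :=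
  x.abs_word_injective (abs_eq_abs.2 h)

theorem exists_abs_word_eq (x y : SignedPerm n) (j : Fin n) :
    ∃ i, x.word i = y.word j ∨ x.word i = -y.word j := by
  obtain ⟨i, -, hi⟩ := x.bijOn_abs.surjOn (y.bijOn_abs.mapsTo (Set.mem_univ j))
  exact ⟨i, abs_eq_abs.1 hi⟩

instance : Finite (SignedPerm n) := by
  refine Finite.of_injective
    (fun (x : SignedPerm n) (j : Fin n) => (⟨x.word j, ?_⟩ : Set.Icc (-(n : ℤ)) n)) ?_
  · exact abs_le.1 (x.bijOn_abs.mapsTo (Set.mem_univ j)).2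
  · intro x y hxy
    ext j
    exact congrArg Subtype.val (congrFun hxy j)

/-- The identity. -/
def one (n : ℕ) : SignedPerm n where
  word j := (j : ℤ) + 1
  bijOn_abs := by
    refine ⟨fun j _ => ?_, fun i _ j _ hij => ?_, fun c hc => ?_⟩
    · have := j.2
      simp only [Set.mem_Icc]
      rw [abs_of_nonneg (by omega)]
      omega
    · simp only at hij
      rw [abs_of_nonneg (by omega), abs_of_nonneg (by omega)] at hij
      ext
      omega
    · rw [Set.mem_Icc] at hc
      refine ⟨⟨(c - 1).toNat, by omega⟩, Set.mem_univ _, ?_⟩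
      simp only
      rw [abs_of_nonneg (by omega)]
      omega

/-- Change the sign of the letter in position `p`. -/
def flip (p : Fin n) (x : SignedPerm n) : SignedPerm n where
  word j := if j = p then -x.word j else x.word j
  bijOn_abs := by
    convert x.bijOn_abs using 2 with j
    split_ifs <;> simp

theorem word_prefixReversal_self (i : Fin n) (x : SignedPerm n) :
    (x.prefixReversal i).word i = -x.word ⟨0, i.pos⟩ := by
  simp [prefixReversal, revPos]

theorem word_prefixReversal_zero (i : Fin n) (x : SignedPerm n) :
    (x.prefixReversal i).word ⟨0, i.pos⟩ = -x.word i := by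
  have h : (⟨0, i.pos⟩ : Fin n) ≤ i := Nat.zero_le _
  simp only [prefixReversal, revPos, h, if_true, Nat.sub_zero]

theorem word_prefixReversal_of_lt {i j : Fin n} (h : i < j) (x : SignedPerm n) :
    (x.prefixReversal i).word j = x.word j := by
  simp [prefixReversal, revPos, h.not_ge]

theorem prefixReversal_injective (x : SignedPerm n) :
    Function.Injective fun i => x.prefixReversal i := by
  intro i j hij
  have := congrArg (fun y : SignedPerm n => y.word ⟨0, i.pos⟩) hij
  simp only [word_prefixReversal_zero, neg_inj] at this
  exact x.eq_of_word_eq_or_eq_neg (Or.inl this)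

theorem word_flip_self (p : Fin n) (x : SignedPerm n) : (x.flip p).word p = -x.word p := by
  simp [flip]

theorem word_flip_of_ne {p j : Fin n} (h : j ≠ p) (x : SignedPerm n) :
    (x.flip p).word j = x.word j := by
  simp [flip, h]

/-- The signed permutations that agree with `x` in the positions from `m` on. -/
def cell (x : SignedPerm n) (m : ℕ) : Set (SignedPerm n) :=
  {y | ∀ j : Fin n, m ≤ j.val → y.word j = x.word j}

theorem self_mem_cell (x : SignedPerm n) (m : ℕ) : x ∈ x.cell m := fun _ _ => rfl

theorem prefixReversal_mem_cell {x y : SignedPerm n} {m : ℕ} (hy : y ∈ x.cell m) {i : Fin n}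
    (hi : i.val < m) : y.prefixReversal i ∈ x.cell m := fun j hj => by
  rw [word_prefixReversal_of_lt (Fin.lt_def.2 (hi.trans_le hj)), hy j hj]

theorem flip_mem_cell {x y : SignedPerm n} {m : ℕ} (hy : y ∈ x.cell m) {i : Fin n}
    (hi : i.val < m) : y.flip i ∈ x.cell m := fun j hj => by
  rw [word_flip_of_ne (fun h => by subst h; omega), hy j hj]

theorem prefixReversal_mem_cell_iff {x : SignedPerm n} {m : ℕ} {i : Fin n} :
    x.prefixReversal i ∈ x.cell m ↔ i.val < m := by
  refine ⟨fun h => ?_, prefixReversal_mem_cell (self_mem_cell x m)⟩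
  by_contra! hi
  have h1 := h i hi
  rw [word_prefixReversal_self] at h1
  have h2 := x.eq_of_word_eq_or_eq_neg (i := i) (j := ⟨0, i.pos⟩) (Or.inr h1.symm)
  have h3 := x.word_ne_zero i
  rw [← h2] at h1
  omega

theorem slice_cell (x₀ : SignedPerm n) (p : Fin n) {x : SignedPerm n}
    (hx : x ∈ x₀.cell (p + 1)) :
    SimpleGraph.slice (x₀.cell (p + 1)) (fun y => y.word p) (x.word p) = x.cell p := by
  ext y
  refine ⟨fun ⟨hy, hyp⟩ j hj => ?_, fun hy => ⟨fun j hj => ?_, hy p le_rfl⟩⟩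
  · rcases hj.lt_or_eq with hj | hj
    · rw [hy j hj, hx j hj]
    · rw [← Fin.ext hj]
      exact hyp
  · rw [hy j (by omega), hx j hj]

/-- The outer neighbour of `x` has label minus the first letter of `x`, so the conditions on labels
concern first letters. Those of `x` and its neighbours are `x₁` and the `-x_i`, all distinct, which
gives `inj`. -/
theorem isLayered_cell (x₀ : SignedPerm n) (p : Fin n) (hp : 1 ≤ p.val)
    (ih : ∀ x : SignedPerm n, (burntPancakeGraph n).ConnectedOn p (x.cell p)) :
    (burntPancakeGraph n).IsLayered (x₀.cell (p + 1)) p (fun x => x.word p)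
      (prefixReversal p) where
  ext_mem x hx := prefixReversal_mem_cell hx (Nat.lt_succ_self _)
  ext_ext x _ := prefixReversal_prefixReversal p x
  adj_ext x _ := ⟨p, rfl⟩
  lab_ne_zero x _ := x.word_ne_zero p
  lab_ext_ne x _ h := by
    rw [word_prefixReversal_self] at h
    have := congrArg Fin.val (x.eq_of_word_eq_or_eq_neg (Or.inr h.symm))
    simp only at this
    omega
  lab_ext_ne_neg x _ h := by
    rw [word_prefixReversal_self, neg_inj] at h
    have := congrArg Fin.val (x.eq_of_word_eq_or_eq_neg (Or.inl h))
    simp only at this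
    omega
  inj x hx y hy z hz hxy hxz h := by
    rw [word_prefixReversal_self, word_prefixReversal_self, neg_inj] at h
    have key : ∀ i : Fin n, x.word ⟨0, p.pos⟩ ≠ -x.word i := by
      intro i hi
      have := x.eq_of_word_eq_or_eq_neg (Or.inr hi)
      subst this
      have := x.word_ne_zero ⟨0, p.pos⟩
      omega
    rcases hxy with rfl | ⟨i, rfl⟩ <;> rcases hxz with rfl | ⟨j, rfl⟩
    · rfl
    · rw [word_prefixReversal_zero] at h
      exact absurd h (key j)
    · rw [word_prefixReversal_zero] at h
      exact absurd h.symm (key i)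
    · rw [word_prefixReversal_zero, word_prefixReversal_zero, neg_inj] at h
      rw [x.eq_of_word_eq_or_eq_neg (Or.inl h)]
  exists_neg x hx := ⟨x.flip p, flip_mem_cell hx (Nat.lt_succ_self _), word_flip_self p x⟩
  le_edges x hx y hy hxy hxy' := by
    let o : Fin n := ⟨0, p.pos⟩
    have hop : p ≠ o := fun h => by
      have := congrArg Fin.val h
      simp only [o] at this
      omega
    -- One edge between the slices comes from bringing the letter `± y.word p` to the front, with a
    -- sign change if needed.
    obtain ⟨v, hv, hvp, hvo⟩ : ∃ v ∈ x₀.cell (p + 1), v.word p = x.word p ∧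
        -v.word o = y.word p := by
      obtain ⟨q, hq⟩ := x.exists_abs_word_eq y p
      have hqp : q < p := by
        rcases lt_trichotomy q p with h | h | h
        · exact h
        · subst h
          omega
        · rw [hx q h, ← hy q h] at hq
          exact absurd (y.eq_of_word_eq_or_eq_neg hq) h.ne'
      have hmem := prefixReversal_mem_cell hx (i := q) (Nat.lt_succ_of_lt hqp)
      have hzero : (x.prefixReversal q).word o = -x.word q := word_prefixReversal_zero q x
      rcases hq with hq | hq
      · refine ⟨x.prefixReversal q, hmem, word_prefixReversal_of_lt hqp x, ?_⟩
        omega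
      · refine ⟨(x.prefixReversal q).flip o, flip_mem_cell hmem (Nat.succ_pos _), ?_, ?_⟩
        · rw [word_flip_of_ne hop, word_prefixReversal_of_lt hqp x]
        · rw [word_flip_self]
          omega
    -- The signs in positions `1, …, p - 1` do not affect the two labels. Changing one of them gives
    -- `p - 1` further edges, and index `0` stands for `v` itself.
    let g : Fin p → SignedPerm n := fun i =>
      if i.val = 0 then v else v.flip ⟨i.val, i.2.trans p.2⟩
    have hg0 : ∀ i, i.val = 0 → g i = v := fun i hi => by simp [g, hi]
    have hg1 : ∀ i, i.val ≠ 0 → g i = v.flip ⟨i.val, i.2.trans p.2⟩ := fun i hi => by simp [g, hi]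
    have hgw : ∀ i (j : Fin n), (g i).word j = v.word j ↔ (i.val = 0 ∨ j.val ≠ i.val) := by
      intro i j
      by_cases hi : i.val = 0
      · simp [hg0 i hi, hi]
      · rw [hg1 i hi]
        by_cases hj : j = ⟨i.val, i.2.trans p.2⟩
        · subst hj
          have := v.word_ne_zero ⟨i.val, i.2.trans p.2⟩
          rw [word_flip_self]
          simp only [hi, ne_eq, not_true_eq_false, or_self, iff_false]
          omega
        · rw [word_flip_of_ne hj]
          simp only [true_iff]
          exact Or.inr fun h => hj (Fin.ext h)
    have hinj : Function.Injective g := by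
      intro i j hij
      have h1 := hgw i ⟨i.val, i.2.trans p.2⟩
      have h2 := hgw j ⟨i.val, i.2.trans p.2⟩
      have h3 := hgw i ⟨j.val, j.2.trans p.2⟩
      have h4 := hgw j ⟨j.val, j.2.trans p.2⟩
      rw [hij, h2] at h1
      rw [hij, h4] at h3
      simp only at h1 h3
      ext
      omega
    have hcard : (Set.range g).ncard = p := by
      rw [← Set.image_univ, Set.ncard_image_of_injective _ hinj, Set.ncard_univ]
      simp
    refine hcard.symm.le.trans (Set.ncard_le_ncard ?_)
    rintro _ ⟨i, rfl⟩
    have hip := i.2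
    refine ⟨?_, ?_, ?_⟩
    · by_cases hi : i.val = 0
      · rw [hg0 i hi]
        exact hv
      · rw [hg1 i hi]
        exact flip_mem_cell hv (Nat.lt_succ_of_lt hip)
    · rw [(hgw i p).2 (Or.inr (by omega)), hvp]
    · rw [word_prefixReversal_self, ← hvo, (hgw i o).2]
      simp only [o]
      omega
  conn x hx := by
    rw [slice_cell x₀ p hx]
    exact ih x
  le_degree x hx := by
    rw [slice_cell x₀ p hx]
    let g : Fin p → SignedPerm n := fun i => x.prefixReversal ⟨i.val, i.2.trans p.2⟩
    have hinj : Function.Injective g := fun i j hij => by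
      have := congrArg Fin.val (x.prefixReversal_injective hij)
      exact Fin.ext this
    have hcard : (Set.range g).ncard = p := by
      rw [← Set.image_univ, Set.ncard_image_of_injective _ hinj, Set.ncard_univ]
      simp
    refine hcard.symm.le.trans (Set.ncard_le_ncard ?_)
    rintro _ ⟨i, rfl⟩
    exact ⟨prefixReversal_mem_cell_iff.2 i.2, _, rfl⟩

theorem cell_one_subset (x : SignedPerm n) (o : Fin n) (ho : o.val = 0) :
    x.cell 1 ⊆ {x, x.prefixReversal o} := by
  intro v hv
  have hne : ∀ j, j ≠ o → v.word j = x.word j := fun j hj =>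
    hv j (Nat.one_le_iff_ne_zero.2 fun h => hj (Fin.ext (h.trans ho.symm)))
  have ho' : v.word o = x.word o ∨ v.word o = -x.word o := by
    obtain ⟨q, hq⟩ := v.exists_abs_word_eq x o
    by_cases hqo : q = o
    · rwa [hqo] at hq
    · rw [hne q hqo] at hq
      exact absurd (x.eq_of_word_eq_or_eq_neg hq) hqo
  have hoz : o = ⟨0, o.pos⟩ := Fin.ext ho
  rcases ho' with h | h
  · left
    ext j
    by_cases hj : j = o
    · rw [hj, h]
    · exact hne j hj
  · right
    ext j
    by_cases hj : j = o
    · rw [hj, h, word_prefixReversal_self, ← hoz]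
    · have hlt : o < j := by
        rw [Fin.lt_def]
        have : j.val ≠ o.val := fun h => hj (Fin.ext h)
        omega
      rw [hne j hj, word_prefixReversal_of_lt hlt]

theorem connectedOn_cell (m : ℕ) (hm : m ≤ n) (x : SignedPerm n) :
    (burntPancakeGraph n).ConnectedOn m (x.cell m) := by
  induction m generalizing x with
  | zero => exact fun D hD => absurd hD (Nat.not_lt_zero _)
  | succ k ih =>
    rcases Nat.eq_zero_or_pos k with rfl | hk
    · intro D hD
      have hD' : D = ∅ := (Set.ncard_eq_zero).1 (by omega)
      subst hD'
      rw [Set.sdiff_empty]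
      have hsub := x.cell_one_subset ⟨0, hm⟩ rfl
      refine SimpleGraph.induce_connected_of_forall_subset (x.self_mem_cell 1)
        fun T hxT hT v hv => ?_
      rcases hsub hv with rfl | rfl
      · exact hxT
      · exact hT x (x.self_mem_cell 1) hxT _ hv ⟨_, rfl⟩
    · exact (x.isLayered_cell ⟨k, hm⟩ hk (ih (by omega))).connectedOn_succ hk
        ⟨x, x.self_mem_cell _⟩

/-- The cell of size `m + 1` carries `m` subgraphs: a cell of size `1` starts with none, and each
new layer adds one. -/
theorem triplePacked_cell (m : ℕ) (hm : m < n) (x : SignedPerm n) :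
    (burntPancakeGraph n).TriplePacked m (x.cell (m + 1)) := by
  induction m generalizing x with
  | zero =>
    exact fun _ _ _ _ _ _ _ _ _ => ⟨Fin.elim0, fun i => i.elim0, fun i => i.elim0,
      fun i => i.elim0, fun i => i.elim0, fun i => i.elim0⟩
  | succ k ih =>
    refine (x.isLayered_cell ⟨k + 1, hm⟩ (Nat.le_add_left _ _)
      (connectedOn_cell _ hm.le)).triplePacked_succ fun y hy => ?_
    rw [slice_cell x ⟨k + 1, hm⟩ hy]
    exact ih (by omega) y

theorem ncard_neighborSet_le (x : SignedPerm n) :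
    ((burntPancakeGraph n).neighborSet x).ncard ≤ n := by
  have : (burntPancakeGraph n).neighborSet x = (fun i => x.prefixReversal i) '' Set.univ := by
    ext y
    simp [burntPancakeGraph]
  rw [this]
  refine (Set.ncard_image_le Set.finite_univ).trans ?_
  simp [Set.ncard_univ]

end SignedPerm

theorem theorem3p1 (n : ℕ) (hn : 2 ≤ n) :
    (burntPancakeGraph n).generalizedConnectivity 3 = ((n - 1 : ℕ) : ℕ∞) := by
  classical
  refine le_antisymm ?_ (le_iInf₂ fun S hS => ?_)
  · let x := SignedPerm.one n
    let y := x.prefixReversal ⟨0, by omega⟩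
    let z := x.prefixReversal ⟨1, by omega⟩
    have hxy : (burntPancakeGraph n).Adj x y := ⟨_, rfl⟩
    have hxz : (burntPancakeGraph n).Adj x z := ⟨_, rfl⟩
    have hyz : y ≠ z := fun h => by simpa using x.prefixReversal_injective h
    refine (iInf₂_le ({x, y, z} : Finset (SignedPerm n))
      (Finset.card_eq_three.2 ⟨x, y, z, hxy.ne, hxz.ne, hyz, rfl⟩)).trans ?_
    refine iSup₂_le fun r ⟨T, hT⟩ => ?_
    have hS : (({x, y, z} : Finset (SignedPerm n)) : Set (SignedPerm n)) = {x, y, z} := by simp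
    rw [hS] at hT
    have := hT.lt_of_adj hxy hxz.ne' hyz.symm (Set.toFinite _) (Set.toFinite _)
      x.ncard_neighborSet_le y.ncard_neighborSet_le
    exact Nat.cast_le.2 (by omega)
  · obtain ⟨x, y, z, hxy, hxz, hyz, rfl⟩ := Finset.card_eq_three.1 hS
    -- A cell of size `n` prescribes no letter, so it is the whole vertex set.
    have hmem : ∀ v : SignedPerm n, v ∈ x.cell (n - 1 + 1) := fun v j hj => by omega
    obtain ⟨P, hP⟩ := x.triplePacked_cell (n - 1) (by omega) x (hmem x) y (hmem y) z (hmem z)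
      hxy hxz hyz
    simpa using hP.le_treeConnectivity
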